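/- Let $k$ be a field and ${\sf C}$ a $k$-linear abelian category. **$\mathbb{Z}$-algebras.** A $\mathbb{Z}$-algebra over $k$ is a family of $k$-modules $A_{ij}$ ($i,j\in\mathbb{Z}$) with associative $k$-bilinear multiplications $A_{ij}\times A_{jl}\to A_{il}$ and units $e_i\in A_{ii}$. It is *connected* if $A_{ij}=0$ for $i>j$, each $A_{ii}$ is a division ring, and each $A_{i,i+1}$ is finite-dimensional over $A_{ii}$ and over $A_{i+1,i+1}$. ${\sf Gr}\,A$ is the category of graded right $A$-modules (abelian groups $M_i$ with multiplications $M_i\times A_{ij}\to M_j$), and ${\sf Tors}\,A$ is its full subcategory of those modules each of whose elements generates a right bounded submodule (one that vanishes in all sufficiently large degrees). A full subcategory of an abelian category is *localizing* if it is a Serre subcategory and the quotient functor has a right adjoint. If ${\sf Tors}\,A$ is a Serre subcategory, ${\sf Proj}\,A:={\sf Gr}\,A/{\sf Tors}\,A$, with quotient functor $\pi_A$. **Orbit algebra.** For a sequence $\underline{\mathcal L}=(\mathcal L_i)_{i\in\mathbb Z}$ of objects of ${\sf C}$, $B_{\underline{\mathcal L}}$ is the $\mathbb Z$-algebra with $B_{ij}=\operatorname{Hom}(\mathcal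 L_{-j},\mathcal L_{-i})$ and multiplication given by composition. **Helices.** For a left $D$-module $V$ put ${}^*V=\operatorname{Hom}_D(V,D)$. A *helix* is a sequence $\underline{\mathcal L}$ together with, for each $i$, a sequence (the $i$th Euler sequence) as in (c), such that for all $i$: (a) $D_i:=\operatorname{End}\mathcal L_i$ is a division ring; (b) $\operatorname{Hom}(\mathcal L_i,\mathcal L_{i+1})$ is finite-dimensional over $D_{i+1}$ on the left and over $D_i$ on the right; (c) the sequence $0\to\mathcal L_i\xrightarrow{\eta_i}{}^*\operatorname{Hom}(\mathcal L_i,\mathcal L_{i+1})\otimes_{D_{i+1}}\mathcal L_{i+1}\to\mathcal L_{i+2}\to0$ is exact, where $\eta_i$ is the canonical map $\sum_a\psi_a\otimes x_a$ for dual bases $(x_a)$ of $\operatorname{Hom}(\mathcal L_i,\mathcal L_{i+1})$ and $(\psi_a)$ of its dual; (d) the canonical map $\Phi_i:D_i\to D_{i+2}$, given by the action of $D_i$ on the first two terms of the Euler sequence, is an isomorphism; (e) the canonical map ${}^*\operatorname{Hom}(\mathcal L_i,\mathcal L_{i+1})\to\operatorname{Hom}(\mathcal L_{i+1},\mathcal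 L_{i+2})$ obtained by applying $\operatorname{Hom}(\mathcal L_{i+1},-)$ to the Euler sequence is an isomorphism (of bimodules, via $\Phi_i$). **Noncommutative symmetric algebra.** Let $M$ be a $k$-central bimodule over two division rings. Let $M^{i*}$ denote its $i$-fold right dual if $i\ge0$ and its $(-i)$-fold left dual if $i<0$, and call $M$ *admissible* if every $M^{i*}$ is finite-dimensional on both sides. For admissible $M$, $\mathbb S^{nc}(M)$ is the $\mathbb Z$-algebra generated by the bimodules $M^{i*}$ in its $(i,i+1)$-components (with the ring $E_i$ acting on the left of $M^{i*}$ in its $(i,i)$-component), modulo the images of the unit maps $E_i\to M^{i*}\otimes M^{(i+1)*}$, $1\mapsto\sum_a x_a\otimes x_a^*$. **Theorem.** Let $\underline{\mathcal L}$ be a helix in ${\sf C}$, $B=B_{\underline{\mathcal L}}$ and $n\ge0$ an integer, such that - $\operatorname{Hom}(\mathcal L_j,\mathcal L_i)=0$ for all $j>i$, - $\operatorname{Ext}^1(\mathcal L_i,\mathcal L_{i+l})=0$ for all $i\in\mathbb Z$ and all $l\ge n$, - $B_{ij}$ is finite-dimensional over $B_{jj}$ whenever $i+1\le j\le i+n+1$.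 Then: 1. $B$ is connected; 2. ${\sf Tors}\,B$ is a localizing subcategory of ${\sf Gr}\,B$; 3. $M:=\operatorname{Hom}(\mathcal L_{-1},\mathcal L_0)$, a $D_0$-$D_{-1}$-bimodule, is admissible, and there is a unique homomorphism of $\mathbb Z$-algebras $\varphi:\mathbb S^{nc}(M)\to B$ which is the identity on $D_0$, $D_{-1}$ and $M$ in the components $(0,0)$, $(1,1)$ and $(0,1)$ and which is compatible with the passage to duals, where ${}^*B_{i+1,i+2}$ is identified with $B_{i,i+1}$ by the isomorphism (e). It is bijective on the components $(i,i)$ and $(i,i+1)$ for all $i$. Moreover ${\sf Tors}\,\mathbb S^{nc}(M)$ is localizing in ${\sf Gr}\,\mathbb S^{nc}(M)$, and the restriction functor $\varphi_*:{\sf Gr}\,B\to{\sf Gr}\,\mathbb S^{nc}(M)$ induces a functor $F:{\sf Proj}\,B\to{\sf Proj}\,\mathbb S^{nc}(M)$; that is, there is a functor $F$, unique up to isomorphism, with $F\circ\pi_B\cong\pi_{\mathbb S^{nc}(M)}\circ\varphi_*$. -/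

import Mathlib

open CategoryTheory CategoryTheory.Limits

universe w v u w'

/-! ### ℤ-algebras -/

/-- A `ℤ`-algebra over `k`: `k`-modules `A i j` for `i j : ℤ`, with an associative `k`-bilinear
multiplication `A i j × A j l → A i l` and units `e i ∈ A i i`. -/
structure ZAlgebra (k : Type w) [Field k] where
  /-- the component `A i j` -/
  comp : ℤ → ℤ → Type v
  [grp : ∀ i j, AddCommGroup (comp i j)]
  [mod : ∀ i j, Module k (comp i j)]
  /-- the unit `e i` -/
  one : ∀ i, comp i i
  /-- the multiplication -/
  mul : ∀ {i j l : ℤ}, comp i j → comp j l → comp i l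
  one_mul : ∀ {i j} (a : comp i j), mul (one i) a = a
  mul_one : ∀ {i j} (a : comp i j), mul a (one j) = a
  mul_assoc : ∀ {i j l m} (a : comp i j) (b : comp j l) (c : comp l m),
    mul (mul a b) c = mul a (mul b c)
  add_mul : ∀ {i j l} (a b : comp i j) (c : comp j l), mul (a + b) c = mul a c + mul b c
  mul_add : ∀ {i j l} (a : comp i j) (b c : comp j l), mul a (b + c) = mul a b + mul a c
  smul_mul : ∀ {i j l} (t : k) (a : comp i j) (b : comp j l), mul (t • a) b = t • mul a b
  mul_smul : ∀ {i j l} (t : k) (a : comp i j) (b : comp j l), mul a (t • b) = t • mul a b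

namespace ZAlgebra

variable {k : Type w} [Field k]

attribute [instance] ZAlgebra.grp ZAlgebra.mod

theorem zero_mul (A : ZAlgebra.{w, v} k) {i j l : ℤ} (b : A.comp j l) :
    A.mul (0 : A.comp i j) b = 0 := by
  have h := A.add_mul (0 : A.comp i j) 0 b
  simpa using h

theorem mul_zero (A : ZAlgebra.{w, v} k) {i j l : ℤ} (a : A.comp i j) :
    A.mul a (0 : A.comp j l) = 0 := by
  have h := A.mul_add a (0 : A.comp j l) 0
  simpa using h

/-- `A i i` is a ring. -/
instance ring (A : ZAlgebra.{w, v} k) (i : ℤ) : Ring (A.comp i i) :=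
  { A.grp i i with
    mul := A.mul
    one := A.one i
    mul_assoc := A.mul_assoc
    one_mul := A.one_mul
    mul_one := A.mul_one
    left_distrib := A.mul_add
    right_distrib := A.add_mul
    zero_mul := A.zero_mul
    mul_zero := A.mul_zero }

/-- `A i j` is a left `A i i`-module. -/
instance leftModule (A : ZAlgebra.{w, v} k) (i j : ℤ) : Module (A.comp i i) (A.comp i j) where
  smul a x := A.mul a x
  one_smul := A.one_mul
  mul_smul a b x := A.mul_assoc a b x
  smul_zero := A.mul_zero
  smul_add := A.mul_add
  add_smul := A.add_mul
  zero_smul := A.zero_mul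

/-- `A i j` is a right `A j j`-module. -/
instance rightModule (A : ZAlgebra.{w, v} k) (i j : ℤ) :
    Module (A.comp j j)ᵐᵒᵖ (A.comp i j) where
  smul a x := A.mul x a.unop
  one_smul := A.mul_one
  mul_smul a b x := (A.mul_assoc x b.unop a.unop).symm
  smul_zero a := A.zero_mul a.unop
  smul_add a x y := A.add_mul x y a.unop
  add_smul a b x := A.mul_add x a.unop b.unop
  zero_smul := A.mul_zero

end ZAlgebra

/-- A (possibly noncommutative) ring is a division ring. -/
def IsDivRing (R : Type v) [Ring R] : Prop :=
  Nontrivial R ∧ ∀ a : R, a ≠ 0 → IsUnit a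

namespace ZAlgebra

variable {k : Type w} [Field k]

/-- A connected (positively graded) `ℤ`-algebra. -/
structure IsConnected (A : ZAlgebra.{w, v} k) : Prop where
  positive : ∀ i j : ℤ, j < i → Subsingleton (A.comp i j)
  division : ∀ i : ℤ, IsDivRing (A.comp i i)
  finite_left : ∀ i : ℤ, Module.Finite (A.comp i i) (A.comp i (i + 1))
  finite_right : ∀ i : ℤ, Module.Finite (A.comp (i + 1) (i + 1))ᵐᵒᵖ (A.comp i (i + 1))

/-- Homomorphisms of `ℤ`-algebras. -/
structure Hom (A A' : ZAlgebra.{w, v} k) where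
  /-- the components of the homomorphism -/
  map : ∀ i j : ℤ, A.comp i j →ₗ[k] A'.comp i j
  map_one : ∀ i, map i i (A.one i) = A'.one i
  map_mul : ∀ {i j l} (a : A.comp i j) (b : A.comp j l),
    map i l (A.mul a b) = A'.mul (map i j a) (map j l b)

/-- The objects of the preadditive category attached to a `ℤ`-algebra `A`: one object for each
integer; the morphisms from `i` to `j` are the elements of `A i j` and the composite of
`a : A i j` and `b : A j l` is the product `a b`. -/
structure Ob (A : ZAlgebra.{w, v} k) : Type where
  /-- the index of the object -/
  idx : ℤ

instance category (A : ZAlgebra.{w, v} k) : Category.{v} A.Ob where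
  Hom x y := A.comp x.idx y.idx
  id x := A.one x.idx
  comp a b := A.mul a b
  id_comp := A.one_mul
  comp_id := A.mul_one
  assoc := A.mul_assoc

instance preadditive (A : ZAlgebra.{w, v} k) : Preadditive A.Ob where
  homGroup x y := A.grp x.idx y.idx
  add_comp _ _ _ := A.add_mul
  comp_add _ _ _ := A.mul_add

/-- The category `Gr A` of graded right `A`-modules.  An additive functor `M` from the category
attached to `A` to abelian groups is a family of abelian groups `M i` with biadditive
multiplications `M i × A i j → M j`, `(m, a) ↦ M.map a m`, which are unital and associative. -/
abbrev Gr (A : ZAlgebra.{w, v} k) : Type (v + 1) := A.Ob ⥤+ AddCommGrpCat.{v}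

end ZAlgebra

section AbelianGr

open scoped ZeroObject

variable {J : Type} [Category.{v} J] [Preadditive J]

instance additiveFunctor_containsZero :
    (additiveFunctor J AddCommGrpCat.{v}).ContainsZero where
  exists_zero :=
    ⟨0, isZero_zero _, ⟨fun {_ Y _ _} =>
      (IsZero.obj (isZero_zero (J ⥤ AddCommGrpCat.{v})) Y).eq_of_tgt _ _⟩⟩

instance additiveFunctor_isClosedUnderSubobjects :
    (additiveFunctor J AddCommGrpCat.{v}).IsClosedUnderSubobjects where
  prop_of_mono {F G} f _ hG := ⟨fun {X Y a b} => by
    have : G.Additive := hG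
    rw [← cancel_mono (f.app Y), Preadditive.add_comp, f.naturality, f.naturality, f.naturality,
      G.map_add, Preadditive.comp_add]⟩

instance additiveFunctor_isClosedUnderQuotients :
    (additiveFunctor J AddCommGrpCat.{v}).IsClosedUnderQuotients where
  prop_of_epi {F G} f _ hF := ⟨fun {X Y a b} => by
    have : F.Additive := hF
    rw [← cancel_epi (f.app X), Preadditive.comp_add, ← f.naturality, ← f.naturality,
      ← f.naturality, F.map_add, Preadditive.add_comp]⟩

instance additiveFunctor_isClosedUnderFiniteProducts :
    (additiveFunctor J AddCommGrpCat.{v}).IsClosedUnderFiniteProducts where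
  isClosedUnderLimitsOfShape I _ :=
    { limitsOfShape_le := by
        rintro F ⟨p⟩
        refine ⟨fun {X Y a b} => ?_⟩
        refine (isLimitOfPreserves ((evaluation J AddCommGrpCat.{v}).obj Y) p.isLimit).hom_ext
          fun i => ?_
        have : (p.diag.obj i).Additive := p.prop_diag_obj i
        change F.map (a + b) ≫ (p.π.app i).app Y = (F.map a + F.map b) ≫ (p.π.app i).app Y
        have h : ∀ c : X ⟶ Y, F.map c ≫ (p.π.app i).app Y =
            (p.π.app i).app X ≫ (p.diag.obj i).map c := fun c => (p.π.app i).naturality c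
        rw [Preadditive.add_comp, h, h, h, Functor.map_add, Preadditive.comp_add] }

end AbelianGr

namespace ZAlgebra

variable {k : Type w} [Field k]

/-- `Gr A` is an abelian category. -/
noncomputable instance abelianGr (A : ZAlgebra.{w, v} k) : Abelian A.Gr :=
  inferInstanceAs (Abelian (additiveFunctor A.Ob AddCommGrpCat.{v}).FullSubcategory)

/-- `Tors A`: the graded right `A`-modules `M` such that every (homogeneous) element `m` generates a
right bounded submodule.  The degree `n` part of the submodule generated by `m ∈ M i` is
`{m a | a ∈ A i n}`. -/
def tors (A : ZAlgebra.{w, v} k) : ObjectProperty A.Gr := fun M =>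
  ∀ (i : ℤ) (m : M.obj.obj (Ob.mk i)), ∃ N : ℤ, ∀ n : ℤ, N ≤ n →
    ∀ a : (Ob.mk i : A.Ob) ⟶ Ob.mk n, M.obj.map a m = 0

end ZAlgebra

/-- A localizing subcategory of an abelian category: a Serre subcategory such that the quotient
functor has a right adjoint. -/
class IsLocalizing {A : Type u} [Category.{v} A] [Abelian A] (P : ObjectProperty A) : Prop
    extends P.IsSerreClass where
  isLeftAdjoint_Q : P.isoModSerre.Q.IsLeftAdjoint

namespace ZAlgebra

variable {k : Type w} [Field k]

/-- `Proj A` is the quotient category `Gr A / Tors A`: the localization of `Gr A` at the morphisms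
whose kernel and cokernel are in `Tors A`. -/
abbrev Proj (A : ZAlgebra.{w, v} k) [A.tors.IsSerreClass] : Type (v + 1) :=
  A.tors.isoModSerre.Localization

/-- The quotient functor `Gr A ⥤ Proj A`. -/
abbrev proj (A : ZAlgebra.{w, v} k) [A.tors.IsSerreClass] : A.Gr ⥤ A.Proj :=
  A.tors.isoModSerre.Q

namespace Hom

variable {A A' : ZAlgebra.{w, v} k}

/-- The functor between the categories attached to `A` and `A'` given by a homomorphism. -/
def functor (φ : Hom A A') : A.Ob ⥤ A'.Ob where
  obj x := Ob.mk x.idx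
  map {x y} a := φ.map x.idx y.idx a
  map_id x := φ.map_one x.idx
  map_comp a b := φ.map_mul a b

instance functor_additive (φ : Hom A A') : φ.functor.Additive where
  map_add {x y a b} := (φ.map x.idx y.idx).map_add a b

/-- The restriction functor `Gr A' ⥤ Gr A` along a homomorphism `φ : A → A'`: the restriction
of `M` has the same components as `M`, and `a` acts as `φ a`. -/
def restriction (φ : Hom A A') : A'.Gr ⥤ A.Gr :=
  ObjectProperty.lift _
    (AdditiveFunctor.forget A'.Ob AddCommGrpCat.{v} ⋙
      (Functor.whiskeringLeft A.Ob A'.Ob AddCommGrpCat.{v}).obj φ.functor)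
    (fun M => inferInstanceAs ((φ.functor ⋙ M.obj).Additive))

end Hom

end ZAlgebra

/-! ### Bimodules and their iterated duals -/

/-- A `k`-central bimodule `M` over `k`-algebras `L` (acting on the left) and `R` (acting on the
right). -/
structure CentralBimodule (k : Type w) [Field k] where
  /-- the ring acting on the left -/
  L : Type v
  /-- the ring acting on the right -/
  R : Type v
  /-- the underlying group -/
  M : Type v
  [ringL : Ring L]
  [ringR : Ring R]
  [algL : Algebra k L]
  [algR : Algebra k R]
  [grp : AddCommGroup M]
  [modL : Module L M]
  [modR : Module Rᵐᵒᵖ M]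
  [comm : SMulCommClass L Rᵐᵒᵖ M]
  central : ∀ (c : k) (x : M), algebraMap k L c • x = MulOpposite.op (algebraMap k R c) • x

namespace CentralBimodule

variable {k : Type w} [Field k]

attribute [instance] ringL ringR algL algR grp modL modR comm

/-- The right action of `L` on the right dual of `X`: `(f l)(x) = f (l x)`. -/
instance rightDualModule (X : CentralBimodule.{w, v} k) : Module X.Lᵐᵒᵖ (X.M →ₗ[X.Rᵐᵒᵖ] X.R) where
  smul l f :=
    { toFun := fun x => f (l.unop • x)
      map_add' := fun x y => by rw [smul_add, map_add]
      map_smul' := fun r x => by rw [smul_comm, map_smul]; rfl }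
  one_smul f := LinearMap.ext fun x => congrArg f (one_smul X.L x)
  mul_smul l l' f := LinearMap.ext fun x => congrArg f (mul_smul l'.unop l.unop x)
  smul_zero l := rfl
  smul_add l f g := rfl
  add_smul l l' f := LinearMap.ext fun x =>
    (congrArg f (add_smul l.unop l'.unop x)).trans (map_add f _ _)
  zero_smul f := LinearMap.ext fun x => (congrArg f (zero_smul X.L x)).trans (map_zero f)

theorem rightDual_smul_apply (X : CentralBimodule.{w, v} k) (l : X.Lᵐᵒᵖ) (f : X.M →ₗ[X.Rᵐᵒᵖ] X.R) (x : X.M) :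
    (l • f) x = f (l.unop • x) := rfl

/-- The right dual `M* = Hom_R(M, R)`, an `R`-`L`-bimodule: `(r f l)(x) = r f(l x)`. -/
def rightDual (X : CentralBimodule.{w, v} k) : CentralBimodule.{w, v} k where
  L := X.R
  R := X.L
  M := X.M →ₗ[X.Rᵐᵒᵖ] X.R
  comm := ⟨fun _ _ _ => rfl⟩
  central c f := LinearMap.ext fun x => by
    rw [LinearMap.smul_apply, rightDual_smul_apply, MulOpposite.unop_op, X.central, map_smul,
      smul_eq_mul, MulOpposite.smul_eq_mul_unop, MulOpposite.unop_op, Algebra.commutes]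

/-- The left action of `R` on the left dual of `X`: `(r f)(x) = f (x r)`. -/
instance leftDualModule (X : CentralBimodule.{w, v} k) : Module X.R (X.M →ₗ[X.L] X.L) where
  smul r f :=
    { toFun := fun x => f (MulOpposite.op r • x)
      map_add' := fun x y => by rw [smul_add, map_add]
      map_smul' := fun l x => by rw [← smul_comm, map_smul]; rfl }
  one_smul f := LinearMap.ext fun x => congrArg f (one_smul X.Rᵐᵒᵖ x)
  mul_smul r r' f := LinearMap.ext fun x =>
    congrArg f (mul_smul (MulOpposite.op r') (MulOpposite.op r) x)
  smul_zero r := rfl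
  smul_add r f g := rfl
  add_smul r r' f := LinearMap.ext fun x =>
    (congrArg f (add_smul (MulOpposite.op r) (MulOpposite.op r') x)).trans (map_add f _ _)
  zero_smul f := LinearMap.ext fun x => (congrArg f (zero_smul X.Rᵐᵒᵖ x)).trans (map_zero f)

theorem leftDual_smul_apply (X : CentralBimodule.{w, v} k) (r : X.R) (f : X.M →ₗ[X.L] X.L) (x : X.M) :
    (r • f) x = f (MulOpposite.op r • x) := rfl

/-- The left dual `*M = Hom_L(M, L)`, an `R`-`L`-bimodule: `(r f l)(x) = f(x r) l`. -/
def leftDual (X : CentralBimodule.{w, v} k) : CentralBimodule.{w, v} k where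
  L := X.R
  R := X.L
  M := X.M →ₗ[X.L] X.L
  comm := ⟨fun _ _ _ => rfl⟩
  central c f := LinearMap.ext fun x => by
    rw [LinearMap.smul_apply, leftDual_smul_apply, ← X.central, map_smul,
      smul_eq_mul, MulOpposite.smul_eq_mul_unop, MulOpposite.unop_op, Algebra.commutes]

/-- The `n`-fold right dual. -/
def rightIter (X : CentralBimodule.{w, v} k) : ℕ → CentralBimodule.{w, v} k
  | 0 => X
  | n + 1 => (rightIter X n).rightDual

/-- The `n`-fold left dual. -/
def leftIter (X : CentralBimodule.{w, v} k) : ℕ → CentralBimodule.{w, v} k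
  | 0 => X
  | n + 1 => (leftIter X n).leftDual

/-- The iterated dual `M^{i*}`: the `i`-fold right dual if `i ≥ 0`, the `(-i)`-fold left dual if
`i < 0`. -/
def iter (X : CentralBimodule.{w, v} k) : ℤ → CentralBimodule.{w, v} k
  | Int.ofNat n => rightIter X n
  | Int.negSucc n => leftIter X (n + 1)

/-- A bimodule all of whose iterated duals are finitely generated on both sides. -/
def IsAdmissible (X : CentralBimodule.{w, v} k) : Prop :=
  ∀ i : ℤ, Module.Finite (X.iter i).L (X.iter i).M ∧ Module.Finite (X.iter i).Rᵐᵒᵖ (X.iter i).M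

/-- The ring acting on the right of `M^{i*}` is the one acting on the left of `M^{(i+1)*}`; this is
the identity map between the two. -/
def iterRL (X : CentralBimodule.{w, v} k) : ∀ i : ℤ, (X.iter i).R → (X.iter (i + 1)).L
  | Int.ofNat n => fun r => (r : (rightIter X n).R)
  | Int.negSucc 0 => fun r => (r : X.L)
  | Int.negSucc (n + 1) => fun r => (r : (leftIter X (n + 1)).L)

/-- The evaluation pairing of `M^{(i+1)*}` and `M^{i*}`: for `i ≥ 0`, `M^{(i+1)*}` is the right dual
of `M^{i*}` and `y`, `x` go to `y x`; for `i < 0`, `M^{i*}` is the left dual of `M^{(i+1)*}` and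
`y`, `x` go to `x y`. -/
def iterPair (X : CentralBimodule.{w, v} k) :
    ∀ i : ℤ, (X.iter (i + 1)).M → (X.iter i).M → (X.iter (i + 1)).L
  | Int.ofNat n => fun (y : (rightIter X n).M →ₗ[(rightIter X n).Rᵐᵒᵖ] (rightIter X n).R) x => y x
  | Int.negSucc 0 => fun (y : X.M) (x : X.M →ₗ[X.L] X.L) => x y
  | Int.negSucc (n + 1) => fun (y : (leftIter X (n + 1)).M)
      (x : (leftIter X (n + 1)).M →ₗ[(leftIter X (n + 1)).L] (leftIter X (n + 1)).L) => x y

end CentralBimodule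

/-! ### The noncommutative symmetric algebra of a bimodule -/

namespace Snc

variable {k : Type w} [Field k]

/-- Expressions in the generators of the noncommutative symmetric algebra of `X`. -/
inductive Pre (X : CentralBimodule.{w, v} k) : ℤ → ℤ → Type v
  | deg0 (i : ℤ) (d : (X.iter i).L) : Pre X i i
  | deg1 (i : ℤ) (x : (X.iter i).M) : Pre X i (i + 1)
  | zero (i j : ℤ) : Pre X i j
  | add {i j : ℤ} (a b : Pre X i j) : Pre X i j
  | neg {i j : ℤ} (a : Pre X i j) : Pre X i j
  | mul {i j l : ℤ} (a : Pre X i j) (b : Pre X j l) : Pre X i l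

/-- The sum of a finite family of expressions. -/
def Pre.sum {X : CentralBimodule.{w, v} k} {i j : ℤ} {n : ℕ} (f : Fin n → Pre X i j) : Pre X i j :=
  (List.ofFn f).foldr Pre.add (Pre.zero i j)

/-- The relations of the noncommutative symmetric algebra of `X`.  Up to `deg1_rsmul` they define
the tensor `ℤ`-algebra of the sequence of bimodules `M^{i*}`; `unit` kills the image of the unit map
from the ring `D_i` acting on the left of `M^{i*}` to `M^{i*} ⊗ M^{(i+1)*}`, which sends `1` to
`∑ x a ⊗ y a` for dual bases `x`, `y`. -/
inductive Rel (X : CentralBimodule.{w, v} k) : ∀ {i j : ℤ}, Pre X i j → Pre X i j → Prop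
  | add_assoc {i j} (a b c : Pre X i j) : Rel X ((a.add b).add c) (a.add (b.add c))
  | add_comm {i j} (a b : Pre X i j) : Rel X (a.add b) (b.add a)
  | zero_add {i j} (a : Pre X i j) : Rel X ((Pre.zero i j).add a) a
  | neg_add {i j} (a : Pre X i j) : Rel X (a.neg.add a) (Pre.zero i j)
  | mul_assoc {i j l m} (a : Pre X i j) (b : Pre X j l) (c : Pre X l m) :
      Rel X ((a.mul b).mul c) (a.mul (b.mul c))
  | one_mul {i j} (a : Pre X i j) : Rel X ((Pre.deg0 i 1).mul a) a
  | mul_one {i j} (a : Pre X i j) : Rel X (a.mul (Pre.deg0 j 1)) a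
  | add_mul {i j l} (a b : Pre X i j) (c : Pre X j l) :
      Rel X ((a.add b).mul c) ((a.mul c).add (b.mul c))
  | mul_add {i j l} (a : Pre X i j) (b c : Pre X j l) :
      Rel X (a.mul (b.add c)) ((a.mul b).add (a.mul c))
  | central {i j} (c : k) (a : Pre X i j) :
      Rel X ((Pre.deg0 i (algebraMap k _ c)).mul a) (a.mul (Pre.deg0 j (algebraMap k _ c)))
  | add_left {i j} {a a' : Pre X i j} (b : Pre X i j) : Rel X a a' → Rel X (a.add b) (a'.add b)
  | add_right {i j} (a : Pre X i j) {b b' : Pre X i j} : Rel X b b' → Rel X (a.add b) (a.add b')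
  | neg {i j} {a a' : Pre X i j} : Rel X a a' → Rel X a.neg a'.neg
  | mul_left {i j l} {a a' : Pre X i j} (b : Pre X j l) : Rel X a a' → Rel X (a.mul b) (a'.mul b)
  | mul_right {i j l} (a : Pre X i j) {b b' : Pre X j l} :
      Rel X b b' → Rel X (a.mul b) (a.mul b')
  | deg0_add (i) (d d' : (X.iter i).L) :
      Rel X (Pre.deg0 i (d + d')) ((Pre.deg0 i d).add (Pre.deg0 i d'))
  | deg0_mul (i) (d d' : (X.iter i).L) :
      Rel X (Pre.deg0 i (d * d')) ((Pre.deg0 i d).mul (Pre.deg0 i d'))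
  | deg1_add (i) (x x' : (X.iter i).M) :
      Rel X (Pre.deg1 i (x + x')) ((Pre.deg1 i x).add (Pre.deg1 i x'))
  | deg1_lsmul (i) (d : (X.iter i).L) (x : (X.iter i).M) :
      Rel X (Pre.deg1 i (d • x)) ((Pre.deg0 i d).mul (Pre.deg1 i x))
  | deg1_rsmul (i) (r : (X.iter i).R) (x : (X.iter i).M) :
      Rel X (Pre.deg1 i (MulOpposite.op r • x))
        ((Pre.deg1 i x).mul (Pre.deg0 (i + 1) (X.iterRL i r)))
  | unit (i) (n : ℕ) (x : Fin n → (X.iter i).M) (y : Fin n → (X.iter (i + 1)).M)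
      (h : ∀ z : (X.iter (i + 1)).M, ∑ a, X.iterPair i z (x a) • y a = z) :
      Rel X (Pre.sum fun a => (Pre.deg1 i (x a)).mul (Pre.deg1 (i + 1) (y a))) (Pre.zero i (i + 1 + 1))

/-- The components of the noncommutative symmetric algebra. -/
def Comp (X : CentralBimodule.{w, v} k) (i j : ℤ) : Type v := Quot (@Rel k _ X i j)

namespace Comp

variable {X : CentralBimodule.{w, v} k}

/-- The class of a degree zero generator. -/
def deg0 (i : ℤ) (d : (X.iter i).L) : Comp X i i := Quot.mk _ (Pre.deg0 i d)

/-- The class of a degree one generator. -/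
def deg1 (i : ℤ) (x : (X.iter i).M) : Comp X i (i + 1) := Quot.mk _ (Pre.deg1 i x)

/-- The multiplication. -/
def mul {i j l : ℤ} : Comp X i j → Comp X j l → Comp X i l :=
  Quot.map₂ Pre.mul (fun a _ _ h => Rel.mul_right a h) (fun _ _ b h => Rel.mul_left b h)

theorem mul_assoc {i j l m : ℤ} (a : Comp X i j) (b : Comp X j l) (c : Comp X l m) :
    mul (mul a b) c = mul a (mul b c) := by
  induction a using Quot.ind
  induction b using Quot.ind
  induction c using Quot.ind
  exact Quot.sound (Rel.mul_assoc _ _ _)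

theorem one_mul {i j : ℤ} (a : Comp X i j) : mul (deg0 i 1) a = a := by
  induction a using Quot.ind
  exact Quot.sound (Rel.one_mul _)

theorem mul_one {i j : ℤ} (a : Comp X i j) : mul a (deg0 j 1) = a := by
  induction a using Quot.ind
  exact Quot.sound (Rel.mul_one _)

theorem central {i j : ℤ} (c : k) (a : Comp X i j) :
    mul (deg0 i (algebraMap k _ c)) a = mul a (deg0 j (algebraMap k _ c)) := by
  induction a using Quot.ind
  exact Quot.sound (Rel.central _ _)

instance addCommGroup (i j : ℤ) : AddCommGroup (Comp X i j) :=
  letI : Add (Comp X i j) :=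
    ⟨Quot.map₂ Pre.add (fun a _ _ h => Rel.add_right a h) (fun _ _ b h => Rel.add_left b h)⟩
  letI : Zero (Comp X i j) := ⟨Quot.mk _ (Pre.zero i j)⟩
  letI : Neg (Comp X i j) := ⟨Quot.map Pre.neg fun _ _ h => Rel.neg h⟩
  have zero_add' : ∀ a : Comp X i j, 0 + a = a := by
    rintro ⟨a⟩
    exact Quot.sound (Rel.zero_add a)
  have add_comm' : ∀ a b : Comp X i j, a + b = b + a := by
    rintro ⟨a⟩ ⟨b⟩
    exact Quot.sound (Rel.add_comm a b)
  { add_assoc := by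
      rintro ⟨a⟩ ⟨b⟩ ⟨c⟩
      exact Quot.sound (Rel.add_assoc a b c)
    zero_add := zero_add'
    add_zero := fun a => (add_comm' a 0).trans (zero_add' a)
    nsmul := nsmulRec
    zsmul := zsmulRec
    neg_add_cancel := by
      rintro ⟨a⟩
      exact Quot.sound (Rel.neg_add a)
    add_comm := add_comm' }

theorem add_mul {i j l : ℤ} (a b : Comp X i j) (c : Comp X j l) :
    mul (a + b) c = mul a c + mul b c := by
  induction a using Quot.ind
  induction b using Quot.ind
  induction c using Quot.ind
  exact Quot.sound (Rel.add_mul _ _ _)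

theorem mul_add {i j l : ℤ} (a : Comp X i j) (b c : Comp X j l) :
    mul a (b + c) = mul a b + mul a c := by
  induction a using Quot.ind
  induction b using Quot.ind
  induction c using Quot.ind
  exact Quot.sound (Rel.mul_add _ _ _)

theorem deg0_add (i : ℤ) (d d' : (X.iter i).L) : deg0 i (d + d') = deg0 i d + deg0 i d' :=
  Quot.sound (Rel.deg0_add i d d')

theorem deg0_mul (i : ℤ) (d d' : (X.iter i).L) : deg0 i (d * d') = mul (deg0 i d) (deg0 i d') :=
  Quot.sound (Rel.deg0_mul i d d')

/-- A scalar `c` acts as multiplication by `c ∈ D_i`. -/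
instance module (i j : ℤ) : Module k (Comp X i j) where
  smul c a := mul (deg0 i (algebraMap k _ c)) a
  one_smul a := by
    change mul (deg0 i (algebraMap k _ 1)) a = a
    rw [map_one, one_mul]
  mul_smul c c' a := by
    change mul (deg0 i (algebraMap k _ (c * c'))) a = mul _ (mul _ a)
    rw [map_mul, deg0_mul, mul_assoc]
  smul_zero c := by
    change mul (deg0 i (algebraMap k _ c)) 0 = 0
    have h := mul_add (deg0 i (algebraMap k _ c)) (0 : Comp X i j) 0
    simpa using h
  smul_add c a b := mul_add _ a b
  add_smul c c' a := by
    change mul (deg0 i (algebraMap k _ (c + c'))) a = mul _ a + mul _ a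
    rw [map_add, deg0_add, add_mul]
  zero_smul a := by
    change mul (deg0 i (algebraMap k _ 0)) a = 0
    have h := add_mul (deg0 i (0 : (X.iter i).L)) (deg0 i 0) a
    rw [← deg0_add, _root_.add_zero] at h
    rw [map_zero]
    simpa using h

end Comp

end Snc

/-- The noncommutative symmetric algebra `𝕊ⁿᶜ(M)` of a bimodule `M`: the `ℤ`-algebra generated by
the iterated duals `M^{i*}` in its `(i, i+1)` components, modulo the images of the unit maps
`D_i → M^{i*} ⊗ M^{(i+1)*}`. -/
def CentralBimodule.snc {k : Type w} [Field k] (X : CentralBimodule.{w, v} k) : ZAlgebra.{w, v} k where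
  comp := Snc.Comp X
  one i := Snc.Comp.deg0 i 1
  mul := Snc.Comp.mul
  one_mul := Snc.Comp.one_mul
  mul_one := Snc.Comp.mul_one
  mul_assoc := Snc.Comp.mul_assoc
  add_mul := Snc.Comp.add_mul
  mul_add := Snc.Comp.mul_add
  smul_mul t a b := Snc.Comp.mul_assoc _ a b
  mul_smul {i j l} t a b := by
    change Snc.Comp.mul a (Snc.Comp.mul _ b) = Snc.Comp.mul _ (Snc.Comp.mul a b)
    rw [← Snc.Comp.mul_assoc, ← Snc.Comp.mul_assoc, Snc.Comp.central]

/-! ### Helices -/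

section Helix

variable {C : Type u} [Category.{v} C] [Abelian C]

/-- The left dual `*Hom(X, Y)` of the left `End Y`-module `Hom(X, Y)`. -/
abbrev HomDual (X Y : C) : Type v := (X ⟶ Y) →ₗ[End Y] End Y

/-- The left action of `f ∈ End X` on `*Hom(X, Y)`: `(f ψ)(x) = ψ(x ∘ f)`. -/
def HomDual.precomp {X Y : C} (f : End X) (ψ : HomDual X Y) : HomDual X Y where
  toFun x := ψ (f ≫ x)
  map_add' x y := by rw [Preadditive.comp_add, map_add]
  map_smul' d x := by
    have h : f ≫ (d • x) = d • (f ≫ x) := (Category.assoc f x d).symm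
    rw [h, map_smul]
    rfl

/-- The object `*Hom(X, Y) ⊗_D Y`, where `D = End Y`, with its universal property: morphisms from
it to `Z` are the same as maps of right `D`-modules from `*Hom(X, Y)` to `Hom(Y, Z)`. -/
structure DualTensor (X Y : C) where
  /-- the object `*Hom(X, Y) ⊗_D Y` -/
  obj : C
  /-- the morphism `ψ ⊗ - : Y ⟶ *Hom(X, Y) ⊗_D Y` -/
  tmul : HomDual X Y → (Y ⟶ obj)
  tmul_add : ∀ ψ ψ', tmul (ψ + ψ') = tmul ψ + tmul ψ'
  tmul_smul : ∀ (d : End Y) (ψ : HomDual X Y), tmul (MulOpposite.op d • ψ) = d ≫ tmul ψ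
  universal : ∀ (Z : C) (g : HomDual X Y → (Y ⟶ Z)), (∀ ψ ψ', g (ψ + ψ') = g ψ + g ψ') →
    (∀ (d : End Y) (ψ : HomDual X Y), g (MulOpposite.op d • ψ) = d ≫ g ψ) →
    ∃! f : obj ⟶ Z, ∀ ψ, tmul ψ ≫ f = g ψ

namespace DualTensor

variable {X Y : C} (T : DualTensor X Y)

/-- The canonical morphism `η : X ⟶ *Hom(X, Y) ⊗_D Y` is `∑ ψ a ⊗ x a` for dual bases `x` of
`Hom(X, Y)` and `ψ` of `*Hom(X, Y)`. -/
def IsCanonical (η : X ⟶ T.obj) : Prop :=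
  ∃ (n : ℕ) (x : Fin n → (X ⟶ Y)) (ψ : Fin n → HomDual X Y),
    (∀ z : X ⟶ Y, ∑ a, ψ a z • x a = z) ∧ η = ∑ a, x a ≫ T.tmul (ψ a)

theorem precomp_add (f : End X) (ψ ψ' : HomDual X Y) :
    (ψ + ψ').precomp f = ψ.precomp f + ψ'.precomp f := rfl

theorem precomp_smul (f : End X) (d : End Y) (ψ : HomDual X Y) :
    HomDual.precomp f (MulOpposite.op d • ψ) = MulOpposite.op d • ψ.precomp f := rfl

/-- The endomorphism of `*Hom(X, Y) ⊗_D Y` induced by the left action of `f ∈ End X` on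
`*Hom(X, Y)`. -/
noncomputable def act (f : End X) : T.obj ⟶ T.obj :=
  (T.universal T.obj (fun ψ => T.tmul (ψ.precomp f))
    (fun ψ ψ' => by rw [precomp_add, T.tmul_add])
    (fun d ψ => by rw [precomp_smul, T.tmul_smul])).choose

theorem tmul_act (f : End X) (ψ : HomDual X Y) :
    T.tmul ψ ≫ T.act f = T.tmul (ψ.precomp f) :=
  (T.universal T.obj (fun ψ => T.tmul (ψ.precomp f))
    (fun ψ ψ' => by rw [precomp_add, T.tmul_add])
    (fun d ψ => by rw [precomp_smul, T.tmul_smul])).choose_spec.1 ψ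

theorem tmul_sum {n : ℕ} (ψ : Fin n → HomDual X Y) :
    T.tmul (∑ a, ψ a) = ∑ a, T.tmul (ψ a) :=
  map_sum (AddMonoidHom.mk' T.tmul T.tmul_add) ψ Finset.univ

/-- The canonical morphism is compatible with the actions of `End X`. -/
theorem IsCanonical.comp_act {T : DualTensor X Y} {η : X ⟶ T.obj} (h : T.IsCanonical η)
    (f : End X) : η ≫ T.act f = f ≫ η := by
  obtain ⟨n, x, ψ, hx, rfl⟩ := h
  rw [Preadditive.sum_comp, Preadditive.comp_sum]
  have h1 : ∀ a, (f ≫ x a) ≫ T.tmul (ψ a) =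
      ∑ b, x b ≫ T.tmul (MulOpposite.op (ψ b (f ≫ x a)) • ψ a) := fun a => by
    conv_lhs => rw [← hx (f ≫ x a), Preadditive.sum_comp]
    refine Finset.sum_congr rfl fun b _ => ?_
    rw [T.tmul_smul]
    exact Category.assoc _ _ _
  have h2 : ∀ b, (ψ b).precomp f = ∑ a, MulOpposite.op (ψ b (f ≫ x a)) • ψ a := fun b => by
    refine LinearMap.ext fun z => ?_
    have hz : f ≫ z = ∑ a, ψ a z • (f ≫ x a) := by
      conv_lhs => rw [← hx z, Preadditive.comp_sum]
      exact Finset.sum_congr rfl fun a _ => (Category.assoc f (x a) _).symm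
    change ψ b (f ≫ z) = _
    rw [hz, map_sum, LinearMap.sum_apply]
    exact Finset.sum_congr rfl fun a _ => map_smul (ψ b) _ _
  calc ∑ b, (x b ≫ T.tmul (ψ b)) ≫ T.act f
      = ∑ b, ∑ a, x b ≫ T.tmul (MulOpposite.op (ψ b (f ≫ x a)) • ψ a) :=
        Finset.sum_congr rfl fun b _ => by
          rw [Category.assoc, T.tmul_act, h2, T.tmul_sum, Preadditive.comp_sum]
    _ = ∑ a, ∑ b, x b ≫ T.tmul (MulOpposite.op (ψ b (f ≫ x a)) • ψ a) := Finset.sum_comm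
    _ = ∑ a, f ≫ x a ≫ T.tmul (ψ a) :=
        Finset.sum_congr rfl fun a _ => by rw [← h1, Category.assoc]

end DualTensor

/-- An Euler sequence `0 ⟶ X ⟶ *Hom(X, Y) ⊗_D Y ⟶ Z ⟶ 0`: a short exact sequence whose first map
is the canonical one. -/
structure EulerSequence (X Y Z : C) extends DualTensor X Y where
  /-- the first map -/
  η : X ⟶ obj
  isCanonical : toDualTensor.IsCanonical η
  /-- the second map -/
  p : obj ⟶ Z
  zero : η ≫ p = 0
  shortExact : (ShortComplex.mk η p zero).ShortExact

namespace EulerSequence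

variable {X Y Z : C} (S : EulerSequence X Y Z)

/-- The canonical map `Φ : End X → End Z`: `Φ f` is the map induced on cokernels by the action of
`f` on the first two terms of the Euler sequence. -/
noncomputable def Φ (f : End X) : End Z :=
  haveI := S.shortExact.epi_g
  S.shortExact.exact.desc (S.act f ≫ S.p) (by
    change S.η ≫ S.act f ≫ S.p = 0
    rw [← Category.assoc, S.isCanonical.comp_act, Category.assoc, S.zero, comp_zero])

/-- The canonical map `*Hom(X, Y) → Hom(Y, Z)`, obtained by applying `Hom(Y, -)` to the second map
of the Euler sequence. -/
def dualToHom (ψ : HomDual X Y) : Y ⟶ Z := S.tmul ψ ≫ S.p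

end EulerSequence

end Helix

/-- A helix.  The indices `i`, `j = i + 1`, `l = i + 2` of the `i`th Euler sequence are carried along
with proofs of these equalities, in order to avoid transports. The canonical maps in the last two
conditions are automatically a ring homomorphism and a map of bimodules. -/
structure Helix (C : Type u) [Category.{v} C] [Abelian C] where
  /-- the objects of the helix -/
  obj : ℤ → C
  division : ∀ i, IsDivRing (End (obj i))
  finite_left : ∀ i, Module.Finite (End (obj (i + 1))) (obj i ⟶ obj (i + 1))
  finite_right : ∀ i, Module.Finite (End (obj i))ᵐᵒᵖ (obj i ⟶ obj (i + 1))
  /-- the Euler sequences -/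
  euler : ∀ i j l : ℤ, i + 1 = j → i + 2 = l → EulerSequence (obj i) (obj j) (obj l)
  bijective_Φ : ∀ (i j l : ℤ) (hj : i + 1 = j) (hl : i + 2 = l),
    Function.Bijective (euler i j l hj hl).Φ
  bijective_dualToHom : ∀ (i j l : ℤ) (hj : i + 1 = j) (hl : i + 2 = l),
    Function.Bijective (euler i j l hj hl).dualToHom

section Orbit

variable (k : Type w) [Field k] {C : Type u} [Category.{v} C]

/-- The orbit algebra of a sequence of objects: `B i j = Hom(ℒ_{-j}, ℒ_{-i})`, with
multiplication given by composition. -/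
def orbitAlgebra [Preadditive C] [Linear k C] (ℒ : ℤ → C) : ZAlgebra.{w, v} k where
  comp i j := ℒ (-j) ⟶ ℒ (-i)
  one i := 𝟙 (ℒ (-i))
  mul a b := b ≫ a
  one_mul := Category.comp_id
  mul_one := Category.id_comp
  mul_assoc a b c := (Category.assoc c b a).symm
  add_mul a b c := Preadditive.comp_add _ _ _ c a b
  mul_add a b c := Preadditive.add_comp _ _ _ b c a
  smul_mul t a b := Linear.comp_smul _ _ _ b t a
  mul_smul t a b := Linear.smul_comp _ _ _ t b a

/-- `Hom(X, Y)` as an `End Y`-`End X`-bimodule. -/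
def homBimod [Preadditive C] [Linear k C] (X Y : C) : CentralBimodule.{w, v} k where
  L := End Y
  R := End X
  M := X ⟶ Y
  comm := ⟨fun d r x => (Category.assoc _ _ _)⟩
  central c x := by
    rw [Algebra.algebraMap_eq_smul_one, Algebra.algebraMap_eq_smul_one]
    change x ≫ (c • 𝟙 Y) = (c • 𝟙 X) ≫ x
    simp

variable [Abelian C] [Linear k C]

/-- The homomorphism `φ : 𝕊ⁿᶜ(Hom(ℒ_{-1}, ℒ_0)) → B` is the canonical one: it is the identity on
`End ℒ_0`, on `End ℒ_{-1}` and on `Hom(ℒ_{-1}, ℒ_0)`, and it is compatible with duals, that is, it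
takes the evaluation pairing of `M^{(i+1)*}` and `M^{i*}` to the pairing of
`B (i+1) (i+2) = Hom(ℒ_{-i-2}, ℒ_{-i-1})` and `B i (i+1) = Hom(ℒ_{-i-1}, ℒ_{-i})` that comes from
the isomorphism `*Hom(ℒ_{-i-2}, ℒ_{-i-1}) → Hom(ℒ_{-i-1}, ℒ_{-i})` of the helix. -/
structure Helix.IsCanonicalHom (H : Helix C)
    (φ : (homBimod k (H.obj (-1)) (H.obj 0)).snc.Hom (orbitAlgebra k H.obj)) : Prop where
  map_deg0_zero : ∀ d : End (H.obj 0), φ.map 0 0 (Snc.Comp.deg0 0 d) = d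
  map_deg0_one : ∀ d : End (H.obj (-1)), φ.map 1 1 (Snc.Comp.deg0 1 d) = d
  map_deg1_zero : ∀ x : H.obj (-1) ⟶ H.obj 0, φ.map 0 1 (Snc.Comp.deg1 0 x) = x
  map_pair : ∀ (i : ℤ) (x : ((homBimod k (H.obj (-1)) (H.obj 0)).iter i).M)
    (y : ((homBimod k (H.obj (-1)) (H.obj 0)).iter (i + 1)).M)
    (ψ : HomDual (H.obj (-(i + 1 + 1))) (H.obj (-(i + 1)))),
    (H.euler (-(i + 1 + 1)) (-(i + 1)) (-i) (by ring) (by ring)).dualToHom ψ =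
      φ.map i (i + 1) (Snc.Comp.deg1 i x) →
    φ.map (i + 1) (i + 1) (Snc.Comp.deg0 (i + 1) (CentralBimodule.iterPair _ i y x)) =
      ψ (φ.map (i + 1) (i + 1 + 1) (Snc.Comp.deg1 (i + 1) y))

end Orbit

/-! Both localization statements rest on one finiteness property, `HasFiniteTails`: for `i ≤ N`, in
all large degrees `n`, `A i n` is a sum of right multiples of finitely many fixed elements of `A i
N`. It makes `Tors A` closed under extensions, because an element `m` is torsion as soon as all its
multiples of large degree are: only finitely many products `m g_s` have to be killed. It also
provides enough local objects. The torsion-free quotient of `M` embeds in its module of germs at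
infinity of eventually linear maps `A i n → M n`, kernel and cokernel of the composite are torsion,
and the module of germs is saturated, hence local. If every object maps to a local one by a morphism
in `W`, the local objects are reflective and their reflector is the localization at `W`; so `Q` has
a right adjoint (`isLocalizing_tors`).

It is enough to check finite tails one degree at a time. In the orbit algebra, a morphism `ℒ_{-j} ⟶
ℒ_{-i}` with `j` large lifts through the `-(i+2)`th Euler sequence by the vanishing of `Ext¹`; the
middle term is a direct summand of a finite sum of copies of `ℒ_{-i-1}`, so the morphism is a
combination of fixed elements of `B i (i+1)`. In `𝕊ⁿᶜ(M)` the property follows from generation in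
degree one by the right finite bimodules `M^{i*}`.

For the comparison map, the Euler sequences give pairings of `B (i+1) (i+2)` with `B i (i+1)` which
are perfect on both sides, the rings two steps apart being identified by `Φ` (`Helix.duality`).
Starting from `M = B 0 1`, taking duals in both directions identifies every `M^{i*}` with `B i
(i+1)`. This gives admissibility and the values of `φ` on generators. The quadratic relations hold
because consecutive maps of an Euler sequence compose to zero. In degrees zero and one the
generators already exhaust `𝕊ⁿᶜ(M)`, whence bijectivity. Uniqueness holds because perfect pairings
propagate the values from index `0` to all indices. Finally, restriction along any homomorphism
keeps torsion kernels and cokernels torsion, so it descends to `Proj`. -/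

/-! ### Graded modules, elementwise -/

namespace ZAlgebra

variable {k : Type w} [Field k] {A : ZAlgebra.{w, v} k}

namespace Gr

/-- The degree `i` component of a graded module. -/
abbrev deg (M : A.Gr) (i : ℤ) : Type v := M.obj.obj (Ob.mk i)

/-- The action `M i × A i j → M j`. -/
def act (M : A.Gr) {i j : ℤ} (m : M.deg i) (a : A.comp i j) : M.deg j :=
  (M.obj.map (show (Ob.mk i : A.Ob) ⟶ Ob.mk j from a)).hom m

section

variable (M : A.Gr) {i j l : ℤ}

theorem add_act (m m' : M.deg i) (a : A.comp i j) :
    M.act (m + m') a = M.act m a + M.act m' a := map_add _ _ _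

theorem act_add (m : M.deg i) (a b : A.comp i j) :
    M.act m (a + b) = M.act m a + M.act m b := by
  change (M.obj.map ((show (Ob.mk i : A.Ob) ⟶ Ob.mk j from a) + b)).hom m = _
  rw [M.obj.map_add]
  rfl

theorem act_one (m : M.deg i) : M.act m (A.one i) = m := by
  change (M.obj.map (𝟙 (Ob.mk i : A.Ob))).hom m = m
  rw [M.obj.map_id]
  rfl

theorem act_mul (m : M.deg i) (a : A.comp i j) (b : A.comp j l) :
    M.act m (A.mul a b) = M.act (M.act m a) b := by
  change (M.obj.map ((show (Ob.mk i : A.Ob) ⟶ Ob.mk j from a) ≫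
    (show (Ob.mk j : A.Ob) ⟶ Ob.mk l from b))).hom m = _
  rw [M.obj.map_comp]
  rfl

/-- The action as a biadditive map. -/
def actHom (i j : ℤ) : M.deg i →+ A.comp i j →+ M.deg j :=
  AddMonoidHom.mk' (fun m => AddMonoidHom.mk' (M.act m) (M.act_add m))
    (fun m m' => by ext a; exact M.add_act m m' a)

@[simp] theorem zero_act (a : A.comp i j) : M.act (0 : M.deg i) a = 0 := map_zero _

theorem neg_act (m : M.deg i) (a : A.comp i j) : M.act (-m) a = -M.act m a := map_neg _ _

theorem sub_act (m m' : M.deg i) (a : A.comp i j) :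
    M.act (m - m') a = M.act m a - M.act m' a := map_sub _ _ _

theorem act_sum {ι : Type*} (s : Finset ι) (m : M.deg i) (a : ι → A.comp i j) :
    M.act m (∑ t ∈ s, a t) = ∑ t ∈ s, M.act m (a t) := map_sum (M.actHom i j m) a s

end

/-- The components of a morphism of graded modules. -/
def app {M N : A.Gr} (f : M ⟶ N) (i : ℤ) : M.deg i →+ N.deg i := (f.hom.app (Ob.mk i)).hom

theorem app_act {M N : A.Gr} (f : M ⟶ N) {i j : ℤ} (m : M.deg i) (a : A.comp i j) :
    app f j (M.act m a) = N.act (app f i m) a :=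
  ConcreteCategory.congr_hom (f.hom.naturality (show (Ob.mk i : A.Ob) ⟶ Ob.mk j from a)) m

@[simp] theorem app_comp {M N K : A.Gr} (f : M ⟶ N) (g : N ⟶ K) (i : ℤ) (m : M.deg i) :
    app (f ≫ g) i m = app g i (app f i m) := rfl

theorem hom_ext {M N : A.Gr} {f g : M ⟶ N} (h : ∀ i m, app f i m = app g i m) : f = g := by
  apply ObjectProperty.hom_ext
  ext x m
  exact h x.idx m

/-- Morphisms of graded modules from families of additive maps. -/
def homMk {M N : A.Gr} (f : ∀ i, M.deg i →+ N.deg i)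
    (hf : ∀ {i j} (m : M.deg i) (a : A.comp i j), f j (M.act m a) = N.act (f i m) a) : M ⟶ N :=
  ObjectProperty.homMk
    { app := fun x => AddCommGrpCat.ofHom (f x.idx)
      naturality := fun x y a => by
        ext m
        exact hf (i := x.idx) (j := y.idx) m a }

/-- Graded modules from explicit data. -/
def ofData (D : ℤ → Type v) [∀ i, AddCommGroup (D i)]
    (sm : ∀ i j, A.comp i j →+ D i →+ D j)
    (h1 : ∀ i m, sm i i (A.one i) m = m)
    (hm : ∀ i j l (a : A.comp i j) (b : A.comp j l) m,
      sm i l (A.mul a b) m = sm j l b (sm i j a m)) : A.Gr where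
  obj :=
    { obj := fun x => AddCommGrpCat.of (D x.idx)
      map := fun {x y} a => AddCommGrpCat.ofHom (sm x.idx y.idx a)
      map_id := fun x => by
        ext m
        exact h1 x.idx m
      map_comp := fun a b => by
        ext m
        exact hm _ _ _ a b m }
  property := ⟨fun {x y a b} => by
    ext m
    exact DFunLike.congr_fun ((sm x.idx y.idx).map_add a b) m⟩

end Gr

/-! ### Exactness -/

/-- The functor taking a graded module to its degree `i` component. -/
abbrev ev (A : ZAlgebra.{w, v} k) (i : ℤ) : A.Gr ⥤ AddCommGrpCat.{v} :=
  (additiveFunctor A.Ob AddCommGrpCat.{v}).ι ⋙ (evaluation _ _).obj (Ob.mk i)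

/-- Additive functors are closed under subobjects and quotients among all functors, so kernels and
cokernels are computed degreewise. This allows element chases in `Gr A`. -/
instance preservesFiniteLimits_ev (A : ZAlgebra.{w, v} k) (i : ℤ) :
    PreservesFiniteLimits (A.ev i) := by
  have : ∀ {X Y : A.Gr} (f : X ⟶ Y), PreservesLimit (parallelPair f 0)
      (additiveFunctor A.Ob AddCommGrpCat.{v}).ι :=
    fun f => ObjectProperty.preservesKernels_ι _ f
  have := Functor.preservesFiniteLimits_of_preservesKernels
    (additiveFunctor A.Ob AddCommGrpCat.{v}).ι
  infer_instance

instance preservesFiniteColimits_ev (A : ZAlgebra.{w, v} k) (i : ℤ) :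
    PreservesFiniteColimits (A.ev i) := by
  have : ∀ {X Y : A.Gr} (f : X ⟶ Y), PreservesColimit (parallelPair f 0)
      (additiveFunctor A.Ob AddCommGrpCat.{v}).ι :=
    fun f => ObjectProperty.preservesCokernels_ι _ f
  have := Functor.preservesFiniteColimits_of_preservesCokernels
    (additiveFunctor A.Ob AddCommGrpCat.{v}).ι
  infer_instance

namespace Gr

theorem exists_of_exact {S : ShortComplex A.Gr} (hS : S.Exact) {i : ℤ} (x : S.X₂.deg i)
    (hx : app S.g i x = 0) : ∃ y, app S.f i y = x :=
  (ShortComplex.ab_exact_iff _).1 (hS.map (A.ev i)) x hx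

theorem injective_of_mono {M N : A.Gr} (f : M ⟶ N) [Mono f] (i : ℤ) :
    Function.Injective (app f i) :=
  (AddCommGrpCat.mono_iff_injective _).1 (inferInstanceAs (Mono ((A.ev i).map f)))

theorem surjective_of_epi {M N : A.Gr} (f : M ⟶ N) [Epi f] (i : ℤ) :
    Function.Surjective (app f i) :=
  (AddCommGrpCat.epi_iff_surjective _).1 (inferInstanceAs (Epi ((A.ev i).map f)))

theorem app_eq_zero_of_comp {M N K : A.Gr} {f : M ⟶ N} {g : N ⟶ K} (h : f ≫ g = 0) (i : ℤ)
    (m : M.deg i) : app g i (app f i m) = 0 := by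
  rw [← app_comp, h]
  rfl

/-- An element generating a right bounded submodule. -/
def IsTorsion (M : A.Gr) {i : ℤ} (m : M.deg i) : Prop :=
  ∃ N : ℤ, ∀ n : ℤ, N ≤ n → ∀ a : A.comp i n, M.act m a = 0

theorem tors_iff {M : A.Gr} : A.tors M ↔ ∀ i (m : M.deg i), M.IsTorsion m := Iff.rfl

end Gr

/-! ### Finitely generated tails and the Serre property -/

/-- For `i ≤ N` almost all components of the right ideal `⨁ A i n` are generated by a fixed finite
subset of `A i N`. -/
def HasFiniteTails (A : ZAlgebra.{w, v} k) : Prop :=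
  ∀ i N : ℤ, i ≤ N → ∃ (r : ℕ) (g : Fin r → A.comp i N) (N' : ℤ), ∀ n : ℤ, N' ≤ n →
    ∀ a : A.comp i n, ∃ c : Fin r → A.comp N n, a = ∑ s, A.mul (g s) (c s)

/-- The sum of the positive parts of the bounds dominates each of them, and it makes sense for `r =
0` too. -/
theorem exists_uniform_bound {r : ℕ} {P : Fin r → ℤ → Prop}
    (h : ∀ s, ∃ N : ℤ, ∀ n, N ≤ n → P s n) : ∃ N : ℤ, ∀ n, N ≤ n → ∀ s, P s n := by
  choose N hN using h
  refine ⟨∑ s, max (N s) 0, fun n hn s => hN s n ?_⟩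
  calc N s ≤ max (N s) 0 := le_max_left _ _
    _ ≤ ∑ s, max (N s) 0 :=
      Finset.single_le_sum (f := fun s => max (N s) 0) (fun _ _ => le_max_right _ _)
        (Finset.mem_univ s)
    _ ≤ n := hn

namespace Gr

/-- Under `HasFiniteTails`, torsion can be detected after multiplication by elements of large
degree. -/
theorem isTorsion_of_act (hA : A.HasFiniteTails) (M : A.Gr) {i : ℤ} (m : M.deg i)
    (h : ∃ N : ℤ, ∀ n : ℤ, N ≤ n → ∀ a : A.comp i n, M.IsTorsion (M.act m a)) :
    M.IsTorsion m := by
  obtain ⟨N, hN⟩ := h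
  -- The finitely many torsion elements `m g_s` have a common bound, and every `m a` of large degree
  -- is a sum of multiples of them.
  obtain ⟨r, g, N', hg⟩ := hA i (max i N) (le_max_left _ _)
  obtain ⟨N'', hN''⟩ := exists_uniform_bound fun s => hN _ (le_max_right i N) (g s)
  refine ⟨max N' N'', fun n hn a => ?_⟩
  obtain ⟨c, rfl⟩ := hg n ((le_max_left _ _).trans hn) a
  rw [act_sum]
  refine Finset.sum_eq_zero fun s _ => ?_
  rw [act_mul, hN'' n ((le_max_right _ _).trans hn) s]

theorem IsTorsion.app {M N : A.Gr} (f : M ⟶ N) {i : ℤ} {m : M.deg i} (h : M.IsTorsion m) :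
    N.IsTorsion (app f i m) := by
  obtain ⟨b, hb⟩ := h
  exact ⟨b, fun n hn a => by rw [← app_act, hb n hn a, map_zero]⟩

end Gr

open Gr

-- Only closure under extensions needs finite tails: multiples of `m` of large degree die in the
-- quotient, so they come from the torsion subobject, and `isTorsion_of_act` applies.
open scoped ZeroObject in
theorem isSerreClass_tors (hA : A.HasFiniteTails) : A.tors.IsSerreClass where
  exists_zero := by
    refine ⟨_, isZero_zero A.Gr, tors_iff.2 fun i m => ⟨0, fun n _ a => ?_⟩⟩
    have h := (isZero_zero A.Gr).eq_of_src (𝟙 _) 0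
    have hm : m = 0 := by
      change app (𝟙 _) i m = 0
      rw [h]
      rfl
    rw [hm, zero_act]
  prop_of_mono f _ hY := tors_iff.2 fun i m => by
    obtain ⟨b, hb⟩ := hY i (app f i m)
    refine ⟨b, fun n hn a => injective_of_mono f n ?_⟩
    rw [app_act, map_zero]
    exact hb n hn a
  prop_of_epi f _ hX := tors_iff.2 fun i m => by
    obtain ⟨m, rfl⟩ := surjective_of_epi f i m
    exact IsTorsion.app f (tors_iff.1 hX i m)
  prop_X₂_of_shortExact {S} hS h₁ h₃ := tors_iff.2 fun i m => by
    obtain ⟨b, hb⟩ := tors_iff.1 h₃ i (app S.g i m)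
    refine isTorsion_of_act hA _ m ⟨b, fun n hn a => ?_⟩
    obtain ⟨y, hy⟩ := exists_of_exact hS.exact (S.X₂.act m a) (by rw [app_act, hb n hn a])
    rw [← hy]
    exact IsTorsion.app S.f (tors_iff.1 h₁ n y)

/-- Elementwise description of the morphisms inverted in `Proj A`. -/
theorem isoModSerre_iff_elementwise [A.tors.IsSerreClass] {M N : A.Gr} (f : M ⟶ N) :
    A.tors.isoModSerre f ↔ (∀ i (m : M.deg i), app f i m = 0 → M.IsTorsion m) ∧
      ∀ i (y : N.deg i), ∃ b : ℤ, ∀ n : ℤ, b ≤ n → ∀ a : A.comp i n,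
        ∃ x, app f n x = N.act y a := by
  rw [ObjectProperty.isoModSerre_iff, ObjectProperty.monoModSerre_iff,
    ObjectProperty.epiModSerre_iff]
  refine and_congr ⟨fun h i m hm => ?_, fun h => tors_iff.2 fun i m => ?_⟩
    ⟨fun h i y => ?_, fun h => tors_iff.2 fun i y => ?_⟩
  · obtain ⟨y, hy⟩ := exists_of_exact (ShortComplex.exact_kernel f) m hm
    rw [← hy]
    exact IsTorsion.app (kernel.ι f) (tors_iff.1 h i y)
  · obtain ⟨b, hb⟩ := h i (app (kernel.ι f) i m) (app_eq_zero_of_comp (kernel.condition f) i m)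
    refine ⟨b, fun n hn a => injective_of_mono (kernel.ι f) n ?_⟩
    rw [app_act, map_zero, hb n hn a]
  · obtain ⟨b, hb⟩ := tors_iff.1 h i (app (cokernel.π f) i y)
    refine ⟨b, fun n hn a => exists_of_exact (ShortComplex.exact_cokernel f) (N.act y a) ?_⟩
    exact (app_act _ _ _).trans (hb n hn a)
  · obtain ⟨y, rfl⟩ := surjective_of_epi (cokernel.π f) i y
    obtain ⟨b, hb⟩ := h i y
    refine ⟨b, fun n hn a => ?_⟩
    obtain ⟨x, hx⟩ := hb n hn a
    rw [← app_act, ← hx]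
    exact app_eq_zero_of_comp (cokernel.condition f) n x

end ZAlgebra

/-! ### Localization at a class of morphisms with enough local objects -/

section Reflection

variable {C : Type u} [Category.{v} C] (W : MorphismProperty C)

/-- If every object admits a morphism in `W` to a `W`-local object, then the localization functor
has a right adjoint. -/
theorem isLeftAdjoint_Q_of_exists_isLocal [W.HasTwoOutOfThreeProperty]
    (hW : MorphismProperty.isomorphisms C ≤ W)
    (h : ∀ X : C, ∃ (Y : C) (f : X ⟶ Y), W f ∧ W.isLocal Y) : W.Q.IsLeftAdjoint := by
  -- The given `f : X ⟶ Y` is initial among morphisms from `X` to local objects, so the local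
  -- objects form a reflective subcategory.
  have hR : W.isLocal.ι.IsRightAdjoint := by
    have : ∀ X : C, HasInitial (StructuredArrow X W.isLocal.ι) := fun X => by
      obtain ⟨Y, f, hf, hY⟩ := h X
      let Y' : W.isLocal.FullSubcategory := ⟨Y, hY⟩
      let f' : X ⟶ W.isLocal.ι.obj Y' := f
      let T : StructuredArrow X W.isLocal.ι := StructuredArrow.mk f'
      have hs (Z : StructuredArrow X W.isLocal.ι) :
          ∃ g : Y' ⟶ Z.right, T.hom ≫ W.isLocal.ι.map g = Z.hom := by
        obtain ⟨g, hg⟩ := (Z.right.property f hf).surjective Z.hom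
        exact ⟨ObjectProperty.homMk g, hg⟩
      refine IsInitial.hasInitial (X := T) (IsInitial.ofUniqueHom
        (fun Z => StructuredArrow.homMk (hs Z).choose (hs Z).choose_spec) fun Z m => ?_)
      apply StructuredArrow.ext
      apply ObjectProperty.hom_ext
      apply (Z.right.property f hf).injective
      exact (StructuredArrow.w m).trans (hs Z).choose_spec.symm
    exact isRightAdjointOfStructuredArrowInitials _
  let L := W.isLocal.ι.leftAdjoint
  let adj : L ⊣ W.isLocal.ι := Adjunction.ofIsRightAdjoint _
  have hL : W = (MorphismProperty.isomorphisms _).inverseImage L := by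
    have h1 : W ≤ (MorphismProperty.isomorphisms _).inverseImage L := fun X Y f hf => by
      rw [← ObjectProperty.isLocal_eq_inverseImage_isomorphisms adj]
      rintro _ ⟨Z, rfl⟩
      exact Z.property f hf
    -- In the naturality square of the unit at `f`, both `L f` and the unit at the local object `Y`
    -- are invertible, so the unit at `X` differs from `f ∈ W` by isomorphisms.
    have hu : ∀ X, W (adj.unit.app X) := fun X => by
      obtain ⟨Y, f, hf, hY⟩ := h X
      have h2 : IsIso (L.map f) := h1 _ hf
      have h3 : IsIso (adj.unit.app Y) := by
        have := ObjectProperty.isLocal_adj_unit_app adj Y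
        rwa [ObjectProperty.isLocal_iff_isIso _ _ ⟨⟨Y, hY⟩, rfl⟩ ⟨_, rfl⟩] at this
      refine W.of_postcomp (adj.unit.app X) (W.isLocal.ι.map (L.map f))
        (hW _ (inferInstanceAs (IsIso _))) ?_
      have := adj.unit.naturality f
      dsimp at this
      exact this ▸ W.comp_mem _ _ hf (hW _ h3)
    -- If `L f` is invertible, naturality and two-out-of-three transfer membership in `W` from the
    -- units to `f`.
    refine le_antisymm h1 fun X Y f hf => ?_
    have hf' : IsIso (L.map f) := hf
    refine W.of_postcomp f (adj.unit.app Y) (hu Y) ?_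
    have := adj.unit.naturality f
    dsimp at this
    rw [this]
    exact W.comp_mem _ _ (hu X) (hW _ (inferInstanceAs (IsIso (W.isLocal.ι.map (L.map f)))))
  have : L.IsLocalization W := by
    have := adj.isLocalization
    rwa [← hL] at this
  exact Functor.isLeftAdjoint_of_iso (Localization.compUniqFunctor L W.Q W)

end Reflection

/-! ### The torsion modules form a localizing subcategory -/

namespace ZAlgebra

variable {k : Type w} [Field k] {A : ZAlgebra.{w, v} k}

namespace Gr

/-- A graded module without nonzero torsion elements. -/
def IsTorsionFree (M : A.Gr) : Prop := ∀ i (m : M.deg i), M.IsTorsion m → m = 0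

/-- The torsion elements of degree `i`. -/
def torsionSubgroup (M : A.Gr) (i : ℤ) : AddSubgroup (M.deg i) where
  carrier := {m | M.IsTorsion m}
  zero_mem' := ⟨0, fun n _ a => M.zero_act a⟩
  add_mem' := by
    rintro m m' ⟨b, hb⟩ ⟨b', hb'⟩
    refine ⟨max b b', fun n hn a => ?_⟩
    rw [add_act, hb n ((le_max_left _ _).trans hn), hb' n ((le_max_right _ _).trans hn), add_zero]
  neg_mem' := by
    rintro m ⟨b, hb⟩
    exact ⟨b, fun n hn a => by rw [neg_act, hb n hn, neg_zero]⟩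

theorem IsTorsion.act {M : A.Gr} {i j : ℤ} {m : M.deg i} (h : M.IsTorsion m) (a : A.comp i j) :
    M.IsTorsion (M.act m a) := by
  obtain ⟨b, hb⟩ := h
  exact ⟨b, fun n hn c => by rw [← act_mul, hb n hn]⟩

/-- The quotient of a graded module by its torsion submodule. -/
def torsionFreeQuotient (M : A.Gr) : A.Gr :=
  ofData (fun i => M.deg i ⧸ M.torsionSubgroup i)
    (fun i j => AddMonoidHom.mk'
      (fun a => QuotientAddGroup.map _ _ ((M.actHom i j).flip a)
        (fun _ hm => IsTorsion.act hm a))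
      (fun a b => by
        ext m
        exact congrArg (QuotientAddGroup.mk (s := M.torsionSubgroup j)) (M.act_add m a b)))
    (fun i m => by
      induction m using QuotientAddGroup.induction_on with
      | H m => exact congrArg (QuotientAddGroup.mk (s := M.torsionSubgroup i)) (M.act_one m))
    (fun i j l a b m => by
      induction m using QuotientAddGroup.induction_on with
      | H m => exact congrArg (QuotientAddGroup.mk (s := M.torsionSubgroup l)) (M.act_mul m a b))

/-- The projection to the quotient by the torsion submodule. -/
def toTorsionFreeQuotient (M : A.Gr) : M ⟶ M.torsionFreeQuotient :=
  homMk (fun i => QuotientAddGroup.mk' (M.torsionSubgroup i)) (fun _ _ => rfl)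

theorem toTorsionFreeQuotient_surjective (M : A.Gr) (i : ℤ) :
    Function.Surjective (app M.toTorsionFreeQuotient i) :=
  QuotientAddGroup.mk'_surjective _

theorem toTorsionFreeQuotient_eq_zero (M : A.Gr) {i : ℤ} (m : M.deg i) :
    app M.toTorsionFreeQuotient i m = 0 ↔ M.IsTorsion m :=
  QuotientAddGroup.eq_zero_iff (N := M.torsionSubgroup i) m

/-- If the class of `m` is torsion, all multiples of `m` of large degree are torsion, hence so is
`m` by finite tails. -/
theorem isTorsionFree_torsionFreeQuotient (hA : A.HasFiniteTails) (M : A.Gr) :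
    M.torsionFreeQuotient.IsTorsionFree := by
  rintro i m ⟨b, hb⟩
  obtain ⟨m, rfl⟩ := M.toTorsionFreeQuotient_surjective i m
  rw [toTorsionFreeQuotient_eq_zero]
  refine isTorsion_of_act hA M m ⟨b, fun n hn a => ?_⟩
  rw [← toTorsionFreeQuotient_eq_zero, app_act, hb n hn]

/-- A family of additive maps `A i n → M n` which is `A`-linear in large degrees. -/
def IsEventuallyLinear (M : A.Gr) {i : ℤ} (f : ∀ n, A.comp i n →+ M.deg n) : Prop :=
  ∃ N : ℤ, ∀ n m : ℤ, N ≤ n → N ≤ m → ∀ (a : A.comp i n) (b : A.comp n m),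
    f m (A.mul a b) = M.act (f n a) b

/-- A graded module is saturated if it is torsion-free and the eventually linear families of maps
are given in large degrees by elements of the module. -/
structure IsSaturated (M : A.Gr) : Prop where
  isTorsionFree : M.IsTorsionFree
  exists_elem : ∀ (i : ℤ) (f : ∀ n, A.comp i n →+ M.deg n), M.IsEventuallyLinear f →
    ∃ (m : M.deg i) (N : ℤ), ∀ n, N ≤ n → ∀ a : A.comp i n, M.act m a = f n a

theorem IsTorsionFree.eq_of_act {M : A.Gr} (hM : M.IsTorsionFree) {i : ℤ} {m m' : M.deg i}
    (h : ∃ N : ℤ, ∀ n : ℤ, N ≤ n → ∀ a : A.comp i n, M.act m a = M.act m' a) : m = m' := by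
  obtain ⟨N, hN⟩ := h
  exact sub_eq_zero.1 (hM i _ ⟨N, fun n hn a => by rw [sub_act, hN n hn, sub_self]⟩)

/-- Extending a morphism along a morphism with torsion kernel and cokernel: the value at `y`. -/
theorem IsSaturated.exists_value [A.tors.IsSerreClass] {M : A.Gr} (hM : M.IsSaturated)
    {X Y : A.Gr} (f : X ⟶ Y) (hf : A.tors.isoModSerre f) (h : X ⟶ M) {i : ℤ} (y : Y.deg i) :
    ∃ m : M.deg i, ∃ N : ℤ, ∀ n, N ≤ n → ∀ (a : A.comp i n) (x : X.deg n),
      app f n x = Y.act y a → M.act m a = app h n x := by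
  classical
  rw [isoModSerre_iff_elementwise] at hf
  obtain ⟨hf1, hf2⟩ := hf
  obtain ⟨b, hb⟩ := hf2 i y
  -- The kernel of `f` is torsion and `M` is torsion-free, so `h x` depends only on `f x`.
  have hz : ∀ {n} (x : X.deg n), app f n x = 0 → app h n x = 0 := fun x hx =>
    hM.isTorsionFree _ _ (IsTorsion.app h (hf1 _ x hx))
  have hw : ∀ {n} (x x' : X.deg n), app f n x = app f n x' → app h n x = app h n x' :=
    fun x x' hx => sub_eq_zero.1 (by rw [← map_sub]; exact hz _ (by rw [map_sub, hx, sub_self]))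
  choose g hg using hb
  -- The family `a ↦ h (f⁻¹ (y a))`, which makes sense once `y a` lies in the image of `f`; the
  -- value zero below `b` is irrelevant.
  let F : ∀ n, A.comp i n →+ M.deg n := fun n =>
    if hn : b ≤ n then AddMonoidHom.mk' (fun a => app h n (g n hn a)) (fun a a' => by
      rw [← map_add]
      exact hw _ _ (by rw [map_add, hg, hg, hg, act_add])) else 0
  have hF : ∀ n (hn : b ≤ n) a x, app f n x = Y.act y a → F n a = app h n x := by
    intro n hn a x hx
    simp only [F, dif_pos hn]
    exact hw _ _ (by rw [hg, hx])
  obtain ⟨m, N, hm⟩ := hM.exists_elem i F ⟨b, fun n l hn hl a c => by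
    rw [hF n hn a _ (hg n hn a), hF l hl _ (X.act (g n hn a) c) (by rw [app_act, hg, act_mul]),
      app_act]⟩
  refine ⟨m, max b N, fun n hn a x hx => ?_⟩
  rw [hm n ((le_max_right _ _).trans hn), hF n ((le_max_left _ _).trans hn) a x hx]

/-- Multiples of `y` of large degree lie in the image of `f`. Since `M` is torsion-free, they
determine the value of an extension at `y`; saturation supplies that value. -/
theorem IsSaturated.isLocal [A.tors.IsSerreClass] {M : A.Gr} (hM : M.IsSaturated) :
    A.tors.isoModSerre.isLocal M := by
  intro X Y f hf
  have hf' := hf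
  rw [isoModSerre_iff_elementwise] at hf'
  refine ⟨fun g g' hg => hom_ext fun i y => ?_, fun h => ?_⟩
  · obtain ⟨b, hb⟩ := hf'.2 i y
    refine hM.isTorsionFree.eq_of_act ⟨b, fun n hn a => ?_⟩
    obtain ⟨x, hx⟩ := hb n hn a
    rw [← app_act, ← app_act, ← hx, ← app_comp, ← app_comp]
    exact DFunLike.congr_fun (congrArg (fun t => app t n) hg) x
  · choose G hG using fun (i : ℤ) (y : Y.deg i) => hM.exists_value f hf h y
    -- The property in `exists_value` characterizes `G i y`; additivity, linearity and the extension
    -- property are all verified through it.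
    have hG' : ∀ {i} (y : Y.deg i) (m : M.deg i), (∃ N : ℤ, ∀ n, N ≤ n → ∀ (a : A.comp i n)
        (x : X.deg n), app f n x = Y.act y a → M.act m a = app h n x) → G i y = m := by
      rintro i y m ⟨N, hN⟩
      obtain ⟨N', hN'⟩ := hG i y
      obtain ⟨b, hb⟩ := hf'.2 i y
      refine hM.isTorsionFree.eq_of_act ⟨max b (max N N'), fun n hn a => ?_⟩
      simp only [max_le_iff] at hn
      obtain ⟨x, hx⟩ := hb n hn.1 a
      rw [hN n hn.2.1 a x hx, hN' n hn.2.2 a x hx]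
    refine ⟨homMk (fun i => AddMonoidHom.mk' (G i) fun y y' => hG' _ _ ?_) fun {i j} y c =>
      hG' _ _ ?_, hom_ext fun i x => hG' _ _ ⟨0, fun n hn a x' hx' => ?_⟩⟩
    · obtain ⟨N, hN⟩ := hG i y
      obtain ⟨N', hN'⟩ := hG i y'
      obtain ⟨b, hb⟩ := hf'.2 i y
      refine ⟨max b (max N N'), fun n hn a x hx => ?_⟩
      simp only [max_le_iff] at hn
      obtain ⟨x', hx'⟩ := hb n hn.1 a
      rw [add_act, hN n hn.2.1 a x' hx', hN' n hn.2.2 a (x - x') (by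
        rw [map_sub, hx, hx', add_act, add_sub_cancel_left]), map_sub, add_sub_cancel]
    · obtain ⟨N, hN⟩ := hG i y
      exact ⟨N, fun n hn a x hx => by
        change M.act (M.act (G i y) c) a = _
        rw [← act_mul, hN n hn _ x (by rw [hx, act_mul])]⟩
    -- The two elements have the same image under `f`, so their difference is torsion and `h` kills
    -- it.
    · rw [← app_act, ← sub_eq_zero, ← map_sub]
      refine hM.isTorsionFree _ _ (IsTorsion.app h (hf'.1 _ _ ?_))
      rw [map_sub, hx', app_act]
      exact sub_self _

end Gr

end ZAlgebra

/-! ### Saturation by germs of eventually linear families -/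

namespace ZAlgebra

variable {k : Type w} [Field k] {A : ZAlgebra.{w, v} k}

/-- Multiplication as a biadditive map. -/
def mulHom (A : ZAlgebra.{w, v} k) (i j l : ℤ) : A.comp i j →+ A.comp j l →+ A.comp i l :=
  AddMonoidHom.mk' (fun a => AddMonoidHom.mk' (A.mul a) (A.mul_add a))
    (fun a b => by ext c; exact A.add_mul a b c)

namespace Gr

variable (M : A.Gr)

/-- The eventually linear families. -/
def germs (i : ℤ) : AddSubgroup (∀ n, A.comp i n →+ M.deg n) where
  carrier := {f | M.IsEventuallyLinear f}
  zero_mem' := ⟨0, fun n m _ _ a b => (M.zero_act b).symm⟩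
  add_mem' := by
    rintro f g ⟨b, hb⟩ ⟨c, hc⟩
    refine ⟨max b c, fun n m hn hm x y => ?_⟩
    simp only [max_le_iff] at hn hm
    change f m _ + g m _ = M.act (f n x + g n x) y
    rw [hb n m hn.1 hm.1, hc n m hn.2 hm.2, add_act]
  neg_mem' := by
    rintro f ⟨b, hb⟩
    refine ⟨b, fun n m hn hm x y => ?_⟩
    change -f m _ = M.act (-f n x) y
    rw [hb n m hn hm, neg_act]

/-- The eventually linear families which are eventually zero. -/
def zeroGerms (i : ℤ) : AddSubgroup (M.germs i) where
  carrier := {f | ∃ N : ℤ, ∀ n, N ≤ n → ∀ a, f.1 n a = 0}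
  zero_mem' := ⟨0, fun n _ a => rfl⟩
  add_mem' := by
    rintro f g ⟨b, hb⟩ ⟨c, hc⟩
    refine ⟨max b c, fun n hn x => ?_⟩
    simp only [max_le_iff] at hn
    change f.1 n x + g.1 n x = 0
    rw [hb n hn.1, hc n hn.2, add_zero]
  neg_mem' := by
    rintro f ⟨b, hb⟩
    refine ⟨b, fun n hn x => ?_⟩
    change -f.1 n x = 0
    rw [hb n hn, neg_zero]

/-- The action of `A` on eventually linear families: `(f a)(b) = f (a b)`. -/
def germsAct (i j : ℤ) (a : A.comp i j) : M.germs i →+ M.germs j where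
  toFun f := ⟨fun n => (f.1 n).comp (A.mulHom i j n a), by
    obtain ⟨N, hN⟩ := f.2
    refine ⟨N, fun n m hn hm x y => ?_⟩
    change f.1 m (A.mul a (A.mul x y)) = M.act (f.1 n (A.mul a x)) y
    rw [← A.mul_assoc, hN n m hn hm]⟩
  map_zero' := rfl
  map_add' _ _ := rfl

theorem zeroGerms_le_comap {i j : ℤ} (a : A.comp i j) :
    M.zeroGerms i ≤ (M.zeroGerms j).comap (M.germsAct i j a) := by
  rintro f ⟨N, hN⟩
  exact ⟨N, fun n hn b => hN n hn _⟩

/-- The module of germs of eventually linear families. -/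
def saturation : A.Gr :=
  ofData (fun i => M.germs i ⧸ M.zeroGerms i)
    (fun i j => AddMonoidHom.mk'
      (fun a => QuotientAddGroup.map _ _ (M.germsAct i j a) (M.zeroGerms_le_comap a))
      (fun a b => by
        ext f
        refine congrArg (QuotientAddGroup.mk (s := M.zeroGerms j)) (Subtype.ext ?_)
        funext n
        ext c
        change f.1 n _ = f.1 n _ + f.1 n _
        rw [← map_add]
        exact congrArg _ (A.add_mul a b c)))
    (fun i f => by
      induction f using QuotientAddGroup.induction_on with
      | H f =>
        refine congrArg (QuotientAddGroup.mk (s := M.zeroGerms i)) (Subtype.ext ?_)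
        funext n
        ext c
        exact congrArg (f.1 n) (A.one_mul c))
    (fun i j l a b f => by
      induction f using QuotientAddGroup.induction_on with
      | H f =>
        refine congrArg (QuotientAddGroup.mk (s := M.zeroGerms l)) (Subtype.ext ?_)
        funext n
        ext c
        exact congrArg (f.1 n) (A.mul_assoc a b c))

/-- The class of an eventually linear family. -/
def germ {i : ℤ} (f : M.germs i) : M.saturation.deg i := QuotientAddGroup.mk (s := M.zeroGerms i) f

theorem exists_germ {i : ℤ} (x : M.saturation.deg i) : ∃ f, M.germ f = x :=
  QuotientAddGroup.mk_surjective x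

theorem germ_eq_iff {i : ℤ} (f g : M.germs i) :
    M.germ f = M.germ g ↔ ∃ N : ℤ, ∀ n, N ≤ n → ∀ a, f.1 n a = g.1 n a := by
  have h1 : M.germ f = M.germ g ↔ -f + g ∈ M.zeroGerms i := QuotientAddGroup.eq
  rw [h1]
  refine exists_congr fun N => forall_congr' fun n => forall_congr' fun _ => forall_congr' fun a => ?_
  change -f.1 n a + g.1 n a = 0 ↔ _
  rw [neg_add_eq_zero]

theorem germ_act {i j : ℤ} (f : M.germs i) (a : A.comp i j) :
    M.saturation.act (M.germ f) a = M.germ (M.germsAct i j a f) := rfl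

/-- The linear family given by an element. -/
def constGerm {i : ℤ} (m : M.deg i) : M.germs i :=
  ⟨fun n => M.actHom i n m, 0, fun _ _ _ _ a b => M.act_mul m a b⟩

/-- The canonical morphism from a module to its module of germs. -/
def toSaturation : M ⟶ M.saturation :=
  homMk (fun i => AddMonoidHom.mk' (fun m => M.germ (M.constGerm m)) (fun m m' => by
      refine congrArg (QuotientAddGroup.mk (s := M.zeroGerms i)) (Subtype.ext ?_)
      funext n
      ext c
      exact M.add_act m m' c))
    (fun {i j} m a => by
      refine congrArg (QuotientAddGroup.mk (s := M.zeroGerms j)) (Subtype.ext ?_)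
      funext n
      ext c
      exact (M.act_mul m a c).symm)

theorem app_toSaturation {i : ℤ} (m : M.deg i) :
    app M.toSaturation i m = M.germ (M.constGerm m) := rfl

variable {M}

theorem toSaturation_injective (hM : M.IsTorsionFree) (i : ℤ) :
    Function.Injective (app M.toSaturation i) := fun m m' h => by
  rw [app_toSaturation, app_toSaturation, germ_eq_iff] at h
  exact hM.eq_of_act h

/-- Eventual linearity `f (a b) = (f a) b` says exactly that the germ of `f`, multiplied by `a`, is
the germ of the family given by the element `f a`. Hence the cokernel of `M ⟶ M.saturation` is
torsion. -/
theorem exists_germ_act_eq {i : ℤ} (f : M.germs i) :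
    ∃ N : ℤ, ∀ n, N ≤ n → ∀ a : A.comp i n,
      M.saturation.act (M.germ f) a = app M.toSaturation n (f.1 n a) := by
  obtain ⟨N, hN⟩ := f.2
  refine ⟨N, fun n hn a => ?_⟩
  rw [germ_act, app_toSaturation, germ_eq_iff]
  exact ⟨N, fun m hm b => hN n m hn hm a b⟩

theorem isTorsionFree_saturation (hM : M.IsTorsionFree) : M.saturation.IsTorsionFree := by
  rintro i x ⟨b, hb⟩
  obtain ⟨f, rfl⟩ := M.exists_germ x
  obtain ⟨N, hN⟩ := exists_germ_act_eq f
  refine (M.germ_eq_iff f 0).2 ⟨max b N, fun n hn a => ?_⟩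
  simp only [max_le_iff] at hn
  apply toSaturation_injective hM
  rw [← hN n hn.2, hb n hn.1]
  exact (map_zero (app M.toSaturation n)).symm

/-- An eventually linear family with values in the germs takes values in `M` in large degrees,
because finitely many germs, its values on generators of a tail, control it. As a family in `M` it
is itself a germ, which is the required element. -/
theorem isSaturated_saturation (hA : A.HasFiniteTails) (hM : M.IsTorsionFree) :
    M.saturation.IsSaturated where
  isTorsionFree := isTorsionFree_saturation hM
  exists_elem i φ hφ := by
    classical
    obtain ⟨N, hN⟩ := hφ
    obtain ⟨r, g, N', hg⟩ := hA i (max i N) (le_max_left _ _)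
    choose F hF using fun s => M.exists_germ (φ _ (g s))
    obtain ⟨N'', hN''⟩ := exists_uniform_bound fun s => exists_germ_act_eq (F s)
    -- With `φ (g_s)` the germ of `F_s`, linearity gives `φ (∑ g_s c_s) = ∑ φ (g_s) c_s`, the image
    -- of `∑ F_s (c_s)`.
    have key : ∀ n, max N (max N' N'') ≤ n → ∀ a : A.comp i n,
        ∃ m, app M.toSaturation n m = φ n a := fun n hn a => by
      simp only [max_le_iff] at hn
      obtain ⟨c, rfl⟩ := hg n hn.2.1 a
      refine ⟨∑ s, (F s).1 n (c s), ?_⟩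
      rw [map_sum, map_sum]
      refine Finset.sum_congr rfl fun s _ => ?_
      rw [hN _ n (le_max_right _ _) hn.1, ← hF, hN'' n hn.2.2 s]
    set K := max N (max N' N'') with hK
    choose G hG using key
    let H : ∀ n, A.comp i n →+ M.deg n := fun n =>
      if hn : K ≤ n then AddMonoidHom.mk' (G n hn) (fun a a' => by
        apply toSaturation_injective hM
        rw [map_add, hG, hG, hG, map_add]) else 0
    have hH : ∀ n, K ≤ n → ∀ a, app M.toSaturation n (H n a) = φ n a := fun n hn a => by
      simp only [H, dif_pos hn]
      exact hG n hn a
    let f : M.germs i := ⟨H, K, fun n m hn hm a b => by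
      apply toSaturation_injective hM
      rw [hH m hm, app_act, hH n hn, hN n m ((le_max_left _ _).trans hn)
        ((le_max_left _ _).trans hm)]⟩
    obtain ⟨N₁, hN₁⟩ := exists_germ_act_eq f
    refine ⟨M.germ f, max K N₁, fun n hn a => ?_⟩
    simp only [max_le_iff] at hn
    rw [hN₁ n hn.2, hH n hn.1]

end Gr

/-! ### The right adjoint of the quotient functor -/

open Gr

theorem isLocalizing_tors (hA : A.HasFiniteTails) : IsLocalizing A.tors :=
  haveI := isSerreClass_tors hA
  { isLeftAdjoint_Q := by
      refine isLeftAdjoint_Q_of_exists_isLocal _ (ObjectProperty.isomorphisms_le_isoModSerre _)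
        fun M => ⟨M.torsionFreeQuotient.saturation,
          M.toTorsionFreeQuotient ≫ M.torsionFreeQuotient.toSaturation,
          MorphismProperty.comp_mem _ _ _ ?_ ?_,
          (isSaturated_saturation hA (isTorsionFree_torsionFreeQuotient hA M)).isLocal⟩
      · rw [isoModSerre_iff_elementwise]
        exact ⟨fun i m => (M.toTorsionFreeQuotient_eq_zero m).1,
          fun i y => ⟨0, fun n _ a => M.toTorsionFreeQuotient_surjective n _⟩⟩
      · rw [isoModSerre_iff_elementwise]
        refine ⟨fun i m hm => ?_, fun i y => ?_⟩
        · rw [toSaturation_injective (isTorsionFree_torsionFreeQuotient hA M) i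
            (hm.trans (map_zero _).symm)]
          exact ⟨0, fun n _ a => zero_act _ a⟩
        · obtain ⟨f, rfl⟩ := exists_germ _ y
          obtain ⟨N, hN⟩ := exists_germ_act_eq f
          exact ⟨N, fun n hn a => ⟨_, (hN n hn a).symm⟩⟩ }

/-! ### Restriction along a homomorphism -/

/-- Restriction along a homomorphism inverts the morphisms inverted in `Proj`. -/
theorem Hom.restriction_isInvertedBy {A' : ZAlgebra.{w, v} k} [A.tors.IsSerreClass]
    [A'.tors.IsSerreClass] (φ : Hom A A') :
    A'.tors.isoModSerre.IsInvertedBy (φ.restriction ⋙ A.proj) := by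
  intro M N f hf
  apply A.tors.isoModSerre.Q_inverts
  rw [isoModSerre_iff_elementwise] at hf ⊢
  refine ⟨fun i m hm => ?_, fun i y => ?_⟩
  -- A bound valid for all of `A'` is valid for the elements `φ a`.
  · obtain ⟨b, hb⟩ := hf.1 i m hm
    exact ⟨b, fun n hn a => hb n hn (φ.map i n a)⟩
  · obtain ⟨b, hb⟩ := hf.2 i y
    exact ⟨b, fun n hn a => hb n hn (φ.map i n a)⟩

/-- Restriction along a homomorphism induces an essentially unique functor on `Proj`. -/
theorem Hom.exists_functor_proj {A' : ZAlgebra.{w, v} k} [A.tors.IsSerreClass]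
    [A'.tors.IsSerreClass] (φ : Hom A A') :
    ∃ F : A'.Proj ⥤ A.Proj, Nonempty (A'.proj ⋙ F ≅ φ.restriction ⋙ A.proj) ∧
      ∀ F' : A'.Proj ⥤ A.Proj, Nonempty (A'.proj ⋙ F' ≅ φ.restriction ⋙ A.proj) →
        Nonempty (F' ≅ F) := by
  refine ⟨Localization.lift _ φ.restriction_isInvertedBy A'.proj,
    ⟨Localization.fac _ φ.restriction_isInvertedBy A'.proj⟩, fun F' ⟨e⟩ => ?_⟩
  let _ : Localization.Lifting A'.proj A'.tors.isoModSerre (φ.restriction ⋙ A.proj) F' := ⟨e⟩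
  exact ⟨Localization.liftNatIso A'.proj A'.tors.isoModSerre (φ.restriction ⋙ A.proj)
    (φ.restriction ⋙ A.proj) _ _ (Iso.refl _)⟩

end ZAlgebra

/-! ### Dualities on a `ℤ`-algebra -/

namespace ZAlgebra

variable {k : Type w} [Field k] {A : ZAlgebra.{w, v} k}

theorem one_smul_mul (A : ZAlgebra.{w, v} k) {i j : ℤ} (c : k) (a : A.comp i j) :
    A.mul (c • A.one i) a = c • a := by rw [A.smul_mul, A.one_mul]

theorem mul_smul_one (A : ZAlgebra.{w, v} k) {i j : ℤ} (c : k) (a : A.comp i j) :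
    A.mul a (c • A.one j) = c • a := by rw [A.mul_smul, A.mul_one]

theorem sum_mul (A : ZAlgebra.{w, v} k) {i j l : ℤ} {ι : Type*} (s : Finset ι)
    (a : ι → A.comp i j) (b : A.comp j l) : A.mul (∑ t ∈ s, a t) b = ∑ t ∈ s, A.mul (a t) b :=
  map_sum ((A.mulHom i j l).flip b) a s

theorem mul_sum (A : ZAlgebra.{w, v} k) {i j l : ℤ} {ι : Type*} (s : Finset ι)
    (a : A.comp i j) (b : ι → A.comp j l) : A.mul a (∑ t ∈ s, b t) = ∑ t ∈ s, A.mul a (b t) :=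
  map_sum (A.mulHom i j l a) b s

/-- Pairings which identify `A i (i+1)` with the left dual of `A (i+1) (i+2)`, for which the
product vanishes on the tensors given by dual bases. -/
structure Duality (A : ZAlgebra.{w, v} k) where
  /-- the pairing -/
  pair : ∀ i : ℤ, A.comp (i + 1) (i + 1 + 1) → A.comp i (i + 1) → A.comp (i + 1) (i + 1)
  add_pair : ∀ i y y' x, pair i (y + y') x = pair i y x + pair i y' x
  pair_add : ∀ i y x x', pair i y (x + x') = pair i y x + pair i y x'
  mul_pair : ∀ i d y x, pair i (A.mul d y) x = A.mul d (pair i y x)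
  pair_mul : ∀ i y x d, pair i y (A.mul x d) = A.mul (pair i y x) d
  /-- the ring acting on the right of `A (i+1) (i+2)` is identified with the one acting on the left
  of `A i (i+1)` -/
  twist : ∀ i : ℤ, A.comp (i + 1 + 1) (i + 1 + 1) → A.comp i i
  twist_bijective : ∀ i, Function.Bijective (twist i)
  pair_twist : ∀ i y r x, pair i (A.mul y r) x = pair i y (A.mul (twist i r) x)
  pair_ext : ∀ i x x', (∀ y, pair i y x = pair i y x') → x = x'
  exists_basis : ∀ i, ∃ (n : ℕ) (x : Fin n → A.comp i (i + 1))
    (y : Fin n → A.comp (i + 1) (i + 1 + 1)), ∀ z, ∑ a, A.mul (pair i z (x a)) (y a) = z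
  unit : ∀ (i : ℤ) (n : ℕ) (x : Fin n → A.comp i (i + 1)) (y : Fin n → A.comp (i + 1) (i + 1 + 1)),
    (∀ z, ∑ a, A.mul (pair i z (x a)) (y a) = z) → ∑ a, A.mul (x a) (y a) = 0
  left_faithful : ∀ i (d d' : A.comp i i), (∀ x : A.comp i (i + 1), A.mul d x = A.mul d' x) → d = d'
  right_faithful : ∀ i (d d' : A.comp (i + 1) (i + 1)),
    (∀ x : A.comp i (i + 1), A.mul x d = A.mul x d') → d = d'

namespace Duality

variable (D : Duality A) (i : ℤ)

/-- The pairing as a biadditive map. -/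
def pairHom : A.comp (i + 1) (i + 1 + 1) →+ A.comp i (i + 1) →+ A.comp (i + 1) (i + 1) :=
  AddMonoidHom.mk' (fun y => AddMonoidHom.mk' (D.pair i y) (D.pair_add i y))
    (fun y y' => by ext x; exact D.add_pair i y y' x)

theorem sum_pair {ι : Type*} (s : Finset ι) (y : ι → A.comp (i + 1) (i + 1 + 1)) (x) :
    D.pair i (∑ t ∈ s, y t) x = ∑ t ∈ s, D.pair i (y t) x :=
  map_sum ((D.pairHom i).flip x) y s

theorem pair_sum {ι : Type*} (s : Finset ι) (y) (x : ι → A.comp i (i + 1)) :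
    D.pair i y (∑ t ∈ s, x t) = ∑ t ∈ s, D.pair i y (x t) :=
  map_sum (D.pairHom i y) x s

theorem pair_ext_left (y y') (h : ∀ x, D.pair i y x = D.pair i y' x) : y = y' := by
  obtain ⟨n, c, b, hb⟩ := D.exists_basis i
  rw [← hb y, ← hb y']
  simp only [h]

/-- Pairing both sides with an arbitrary `y` reduces this to the expansion of `y`. It is the
reflexivity that makes the pairing perfect on the other side as well. -/
theorem dual_basis {n : ℕ} {c : Fin n → A.comp i (i + 1)}
    {b : Fin n → A.comp (i + 1) (i + 1 + 1)}
    (hb : ∀ z, ∑ a, A.mul (D.pair i z (c a)) (b a) = z) (x : A.comp i (i + 1)) :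
    ∑ a, A.mul (c a) (D.pair i (b a) x) = x := by
  refine D.pair_ext i _ _ fun y => ?_
  conv_rhs => rw [← hb y]
  rw [pair_sum, sum_pair]
  simp only [pair_mul, mul_pair]

/-- Through this, the adjunction `pair_twist` forces the twist to be a ring homomorphism. -/
theorem twist_ext (d d' : A.comp i i) (h : ∀ y x, D.pair i y (A.mul d x) = D.pair i y (A.mul d' x)) :
    d = d' :=
  D.left_faithful i d d' fun x => D.pair_ext i _ _ fun y => h y x

/-- The twist is an isomorphism of rings. -/
noncomputable def twistEquiv : A.comp (i + 1 + 1) (i + 1 + 1) ≃+* A.comp i i :=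
  { Equiv.ofBijective _ (D.twist_bijective i) with
    map_mul' := fun r s => D.twist_ext i _ _ fun y x => by
      change D.pair i y (A.mul (D.twist i (A.mul r s)) x) =
        D.pair i y (A.mul (A.mul (D.twist i r) (D.twist i s)) x)
      rw [← pair_twist, A.mul_assoc, ← pair_twist, ← pair_twist, A.mul_assoc]
    map_add' := fun r s => D.twist_ext i _ _ fun y x => by
      change D.pair i y (A.mul (D.twist i (r + s)) x) =
        D.pair i y (A.mul (D.twist i r + D.twist i s) x)
      rw [← pair_twist, A.mul_add, add_pair, A.add_mul, pair_add, ← pair_twist, ← pair_twist] }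

theorem twistEquiv_apply (r) : D.twistEquiv i r = D.twist i r := rfl

/-- Scalars are central and pass through either argument of the pairing, so `k`-linearity of the
twist is automatic. -/
theorem twistEquiv_smul_one (c : k) : D.twistEquiv i (c • A.one _) = c • A.one i :=
  D.twist_ext i _ _ fun y x => by
    rw [twistEquiv_apply, ← pair_twist, mul_smul_one, one_smul_mul, ← one_smul_mul, mul_pair,
      one_smul_mul, ← A.mul_smul_one c x, pair_mul, mul_smul_one]

end Duality

/-! ### Identification of iterated duals with the degree one components -/

/-- An isomorphism of a bimodule `Y` with the bimodule `A i (i+1)`, over isomorphisms of the rings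
acting on the two sides. -/
structure BimodIso (A : ZAlgebra.{w, v} k) (i : ℤ) (Y : CentralBimodule.{w, v} k) where
  /-- the isomorphism of the rings acting on the left -/
  left : Y.L ≃+* A.comp i i
  /-- the isomorphism of the rings acting on the right -/
  right : Y.R ≃+* A.comp (i + 1) (i + 1)
  /-- the isomorphism of bimodules -/
  mid : Y.M ≃+ A.comp i (i + 1)
  mid_lsmul : ∀ d x, mid (d • x) = A.mul (left d) (mid x)
  mid_rsmul : ∀ r x, mid (MulOpposite.op r • x) = A.mul (mid x) (right r)
  left_algebraMap : ∀ c : k, left (algebraMap k Y.L c) = c • A.one i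
  right_algebraMap : ∀ c : k, right (algebraMap k Y.R c) = c • A.one (i + 1)

namespace BimodIso

variable {Y : CentralBimodule.{w, v} k} {i : ℤ}

/-- `A (i+1) (i+2)` as the right dual of a bimodule isomorphic to `A i (i+1)`. -/
def toRightDual (D : Duality A) (m : BimodIso A i Y) :
    A.comp (i + 1) (i + 1 + 1) →+ (Y.M →ₗ[Y.Rᵐᵒᵖ] Y.R) :=
  AddMonoidHom.mk' (fun y =>
    { toFun := fun x => m.right.symm (D.pair i y (m.mid x))
      map_add' := fun x x' => by rw [map_add, D.pair_add, map_add]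
      map_smul' := fun r x => by
        rw [← MulOpposite.op_unop r, m.mid_rsmul, D.pair_mul]
        change m.right.symm (D.pair i y (m.mid x) * m.right r.unop) = _
        rw [map_mul, RingEquiv.symm_apply_apply]
        rfl }) fun y y' => by
    ext x
    change m.right.symm _ = m.right.symm _ + m.right.symm _
    rw [D.add_pair, map_add]

theorem right_toRightDual (D : Duality A) (m : BimodIso A i Y) (y) (x : Y.M) :
    m.right (m.toRightDual D y x) = D.pair i y (m.mid x) :=
  m.right.apply_symm_apply _

theorem toRightDual_bijective (D : Duality A) (m : BimodIso A i Y) :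
    Function.Bijective (m.toRightDual D) := by
  refine ⟨fun y y' h => D.pair_ext_left i _ _ fun x => ?_, fun f => ?_⟩
  · obtain ⟨x, rfl⟩ := m.mid.surjective x
    rw [← right_toRightDual, h, right_toRightDual]
  · obtain ⟨n, c, b, hb⟩ := D.exists_basis i
    -- The functional `f` is represented by `∑ f(c_a) b_a`, as seen by expanding `x = ∑ c_a ⟨b_a,
    -- x⟩`.
    refine ⟨∑ a, A.mul (m.right (f (m.mid.symm (c a)))) (b a), ?_⟩
    ext x
    apply m.right.injective
    rw [right_toRightDual, D.sum_pair]
    have hx : x = ∑ a, MulOpposite.op (m.right.symm (D.pair i (b a) (m.mid x))) •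
        m.mid.symm (c a) := by
      apply m.mid.injective
      rw [map_sum]
      conv_lhs => rw [← D.dual_basis i hb (m.mid x)]
      refine Finset.sum_congr rfl fun a _ => ?_
      rw [m.mid_rsmul, AddEquiv.apply_symm_apply, RingEquiv.apply_symm_apply]
    conv_rhs => rw [hx, map_sum, map_sum]
    refine Finset.sum_congr rfl fun a _ => ?_
    rw [D.mul_pair, map_smul, MulOpposite.smul_eq_mul_unop, map_mul, MulOpposite.unop_op,
      RingEquiv.apply_symm_apply]
    rfl

/-- The inverse of `toRightDual`. -/
noncomputable def ofRightDual (D : Duality A) (m : BimodIso A i Y) :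
    (Y.M →ₗ[Y.Rᵐᵒᵖ] Y.R) ≃+ A.comp (i + 1) (i + 1 + 1) :=
  (AddEquiv.ofBijective _ (m.toRightDual_bijective D)).symm

theorem pair_ofRightDual (D : Duality A) (m : BimodIso A i Y) (f : Y.M →ₗ[Y.Rᵐᵒᵖ] Y.R) (x : Y.M) :
    D.pair i (m.ofRightDual D f) (m.mid x) = m.right (f x) := by
  rw [← right_toRightDual]
  exact congrArg (fun g : Y.M →ₗ[Y.Rᵐᵒᵖ] Y.R => m.right (g x))
    ((AddEquiv.ofBijective _ (m.toRightDual_bijective D)).apply_symm_apply f)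

theorem ofRightDual_eq (D : Duality A) (m : BimodIso A i Y) (f : Y.M →ₗ[Y.Rᵐᵒᵖ] Y.R)
    (y : A.comp (i + 1) (i + 1 + 1)) (h : ∀ x, m.right (f x) = D.pair i y (m.mid x)) :
    m.ofRightDual D f = y := by
  refine D.pair_ext_left i _ _ fun x => ?_
  obtain ⟨x, rfl⟩ := m.mid.surjective x
  rw [pair_ofRightDual, h]

theorem ofRightDual_smul (D : Duality A) (m : BimodIso A i Y) (d : Y.R)
    (f : Y.M →ₗ[Y.Rᵐᵒᵖ] Y.R) :
    m.ofRightDual D (d • f) = A.mul (m.right d) (m.ofRightDual D f) :=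
  m.ofRightDual_eq D _ _ fun x => by
    rw [D.mul_pair, pair_ofRightDual]
    exact map_mul m.right d _

/-- The twist enters here: the right action on the dual comes from the left action on `A i (i+1)`,
carried across the pairing. -/
theorem ofRightDual_op_smul (D : Duality A) (m : BimodIso A i Y) (l : Y.L)
    (f : Y.M →ₗ[Y.Rᵐᵒᵖ] Y.R) : m.ofRightDual D (MulOpposite.op l • f) =
      A.mul (m.ofRightDual D f) ((D.twistEquiv i).symm (m.left l)) :=
  m.ofRightDual_eq D _ _ fun x => by
    rw [D.pair_twist, ← D.twistEquiv_apply, RingEquiv.apply_symm_apply, ← m.mid_lsmul,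
      pair_ofRightDual]
    rfl

/-- `A (i+1) (i+2)` is isomorphic to the right dual of `A i (i+1)`. -/
noncomputable def rightDual (D : Duality A) (m : BimodIso A i Y) :
    BimodIso A (i + 1) Y.rightDual where
  left := m.right
  right := m.left.trans (D.twistEquiv i).symm
  mid := m.ofRightDual D
  mid_lsmul d f := m.ofRightDual_smul D d f
  mid_rsmul l f := m.ofRightDual_op_smul D l f
  left_algebraMap := m.right_algebraMap
  right_algebraMap c := by
    change (D.twistEquiv i).symm (m.left (algebraMap k Y.L c)) = _
    rw [m.left_algebraMap, RingEquiv.symm_apply_eq, D.twistEquiv_smul_one]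

/-- `A i (i+1)` as the left dual of a bimodule isomorphic to `A (i+1) (i+2)`. -/
def toLeftDual (D : Duality A) (m : BimodIso A (i + 1) Y) :
    A.comp i (i + 1) →+ (Y.M →ₗ[Y.L] Y.L) :=
  AddMonoidHom.mk' (fun x =>
    { toFun := fun y => m.left.symm (D.pair i (m.mid y) x)
      map_add' := fun y y' => by rw [map_add, D.add_pair, map_add]
      map_smul' := fun d y => by
        rw [m.mid_lsmul, D.mul_pair]
        change m.left.symm (m.left d * D.pair i (m.mid y) x) = _
        rw [map_mul, RingEquiv.symm_apply_apply]
        rfl }) fun x x' => by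
    ext y
    change m.left.symm _ = m.left.symm _ + m.left.symm _
    rw [D.pair_add, map_add]

theorem left_toLeftDual (D : Duality A) (m : BimodIso A (i + 1) Y) (x) (y : Y.M) :
    m.left (m.toLeftDual D x y) = D.pair i (m.mid y) x :=
  m.left.apply_symm_apply _

theorem toLeftDual_bijective (D : Duality A) (m : BimodIso A (i + 1) Y) :
    Function.Bijective (m.toLeftDual D) := by
  refine ⟨fun x x' h => D.pair_ext i _ _ fun y => ?_, fun f => ?_⟩
  · obtain ⟨y, rfl⟩ := m.mid.surjective y
    rw [← left_toLeftDual, h, left_toLeftDual]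
  · obtain ⟨n, c, b, hb⟩ := D.exists_basis i
    -- Here `f` is represented by `∑ c_a f(b_a)`, using the expansion of `y` in the `b_a`.
    refine ⟨∑ a, A.mul (c a) (m.left (f (m.mid.symm (b a)))), ?_⟩
    ext y
    apply m.left.injective
    rw [left_toLeftDual, D.pair_sum]
    have hy : y = ∑ a, m.left.symm (D.pair i (m.mid y) (c a)) • m.mid.symm (b a) := by
      apply m.mid.injective
      rw [map_sum]
      conv_lhs => rw [← hb (m.mid y)]
      refine Finset.sum_congr rfl fun a _ => ?_
      rw [m.mid_lsmul, AddEquiv.apply_symm_apply, RingEquiv.apply_symm_apply]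
    conv_rhs => rw [hy, map_sum, map_sum]
    refine Finset.sum_congr rfl fun a _ => ?_
    rw [D.pair_mul, map_smul, smul_eq_mul, map_mul, RingEquiv.apply_symm_apply]
    rfl

/-- The inverse of `toLeftDual`. -/
noncomputable def ofLeftDual (D : Duality A) (m : BimodIso A (i + 1) Y) :
    (Y.M →ₗ[Y.L] Y.L) ≃+ A.comp i (i + 1) :=
  (AddEquiv.ofBijective _ (m.toLeftDual_bijective D)).symm

theorem pair_ofLeftDual (D : Duality A) (m : BimodIso A (i + 1) Y) (f : Y.M →ₗ[Y.L] Y.L)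
    (y : Y.M) : D.pair i (m.mid y) (m.ofLeftDual D f) = m.left (f y) := by
  rw [← left_toLeftDual]
  exact congrArg (fun g : Y.M →ₗ[Y.L] Y.L => m.left (g y))
    ((AddEquiv.ofBijective _ (m.toLeftDual_bijective D)).apply_symm_apply f)

theorem ofLeftDual_eq (D : Duality A) (m : BimodIso A (i + 1) Y) (f : Y.M →ₗ[Y.L] Y.L)
    (x : A.comp i (i + 1)) (h : ∀ y, m.left (f y) = D.pair i (m.mid y) x) :
    m.ofLeftDual D f = x := by
  refine D.pair_ext i _ _ fun y => ?_
  obtain ⟨y, rfl⟩ := m.mid.surjective y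
  rw [pair_ofLeftDual, h]

theorem ofLeftDual_smul (D : Duality A) (m : BimodIso A (i + 1) Y) (r : Y.R)
    (f : Y.M →ₗ[Y.L] Y.L) :
    m.ofLeftDual D (r • f) = A.mul (D.twistEquiv i (m.right r)) (m.ofLeftDual D f) :=
  m.ofLeftDual_eq D _ _ fun y => by
    rw [D.twistEquiv_apply, ← D.pair_twist, ← m.mid_rsmul, pair_ofLeftDual]
    rfl

theorem ofLeftDual_op_smul (D : Duality A) (m : BimodIso A (i + 1) Y) (l : Y.L)
    (f : Y.M →ₗ[Y.L] Y.L) :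
    m.ofLeftDual D (MulOpposite.op l • f) = A.mul (m.ofLeftDual D f) (m.left l) :=
  m.ofLeftDual_eq D _ _ fun y => by
    rw [D.pair_mul, pair_ofLeftDual]
    exact map_mul m.left _ l

/-- `A i (i+1)` is isomorphic to the left dual of `A (i+1) (i+2)`. -/
noncomputable def leftDual (D : Duality A) (m : BimodIso A (i + 1) Y) :
    BimodIso A i Y.leftDual where
  left := m.right.trans (D.twistEquiv i)
  right := m.left
  mid := m.ofLeftDual D
  mid_lsmul r f := m.ofLeftDual_smul D r f
  mid_rsmul l f := m.ofLeftDual_op_smul D l f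
  left_algebraMap c := by
    change D.twistEquiv i (m.right (algebraMap k Y.R c)) = _
    rw [m.right_algebraMap, D.twistEquiv_smul_one]
  right_algebraMap := m.left_algebraMap

/-- The scalar rings differ, so finiteness is carried along a surjection semilinear over their
isomorphism. -/
theorem finite_left (m : BimodIso A i Y) [Module.Finite (A.comp i i) (A.comp i (i + 1))] :
    Module.Finite Y.L Y.M := by
  let σ : A.comp i i →+* Y.L := m.left.symm
  have : RingHomSurjective σ := ⟨m.left.symm.surjective⟩
  let f : A.comp i (i + 1) →ₛₗ[σ] Y.M :=
    { m.mid.symm with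
      map_smul' := fun d x => by
        apply m.mid.injective
        change m.mid (m.mid.symm (A.mul d x)) = m.mid (m.left.symm d • m.mid.symm x)
        rw [m.mid_lsmul, AddEquiv.apply_symm_apply, AddEquiv.apply_symm_apply,
          RingEquiv.apply_symm_apply] }
  exact Module.Finite.of_surjective f m.mid.symm.surjective

theorem finite_right (m : BimodIso A i Y)
    [Module.Finite (A.comp (i + 1) (i + 1))ᵐᵒᵖ (A.comp i (i + 1))] :
    Module.Finite Y.Rᵐᵒᵖ Y.M := by
  let σ : (A.comp (i + 1) (i + 1))ᵐᵒᵖ →+* Y.Rᵐᵒᵖ := RingHom.op m.right.symm.toRingHom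
  have : RingHomSurjective σ := ⟨fun r => ⟨MulOpposite.op (m.right r.unop),
    MulOpposite.unop_injective (m.right.symm_apply_apply _)⟩⟩
  let f : A.comp i (i + 1) →ₛₗ[σ] Y.M :=
    { m.mid.symm with
      map_smul' := fun d x => by
        apply m.mid.injective
        change m.mid (m.mid.symm (A.mul x d.unop)) =
          m.mid (MulOpposite.op (m.right.symm d.unop) • m.mid.symm x)
        rw [m.mid_rsmul, AddEquiv.apply_symm_apply, AddEquiv.apply_symm_apply,
          RingEquiv.apply_symm_apply] }
  exact Module.Finite.of_surjective f m.mid.symm.surjective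

/-! ### Iterated duals -/

variable {X : CentralBimodule.{w, v} k}

/-- The iterated right duals of `A 0 1`. -/
noncomputable def rightIter (D : Duality A) (m : BimodIso A 0 X) :
    ∀ n : ℕ, BimodIso A (Int.ofNat n) (X.rightIter n)
  | 0 => m
  | n + 1 => (rightIter D m n).rightDual D

/-- The iterated left duals of `A 0 1`. -/
noncomputable def leftIter (D : Duality A) (m : BimodIso A 0 X) :
    ∀ n : ℕ, BimodIso A (Int.negSucc n) (X.leftIter (n + 1))
  | 0 => BimodIso.leftDual (i := Int.negSucc 0) D m
  | n + 1 => BimodIso.leftDual (i := Int.negSucc (n + 1)) D (leftIter D m n)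

/-- If `X` is isomorphic to `A 0 1` then its iterated duals are isomorphic to the `A i (i+1)`. -/
noncomputable def iter (D : Duality A) (m : BimodIso A 0 X) : ∀ i : ℤ, BimodIso A i (X.iter i)
  | Int.ofNat n => rightIter D m n
  | Int.negSucc n => leftIter D m n

/-- Passing to a dual reuses the isomorphism of the shared middle ring unchanged; the twist only
affects the outer ring. -/
theorem iter_left_iterRL (D : Duality A) (m : BimodIso A 0 X) (i : ℤ) (r : (X.iter i).R) :
    (iter D m (i + 1)).left (X.iterRL i r) = (iter D m i).right r := by
  match i, r with
  | Int.ofNat n, r => rfl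
  | Int.negSucc 0, r => rfl
  | Int.negSucc (n + 1), r => rfl

theorem iter_left_iterPair (D : Duality A) (m : BimodIso A 0 X) (i : ℤ) (y : (X.iter (i + 1)).M)
    (x : (X.iter i).M) :
    (iter D m (i + 1)).left (X.iterPair i y x) =
      D.pair i ((iter D m (i + 1)).mid y) ((iter D m i).mid x) := by
  match i, y, x with
  | Int.ofNat n, y, x => exact (pair_ofRightDual D (rightIter D m n) y x).symm
  | Int.negSucc 0, y, x => exact (pair_ofLeftDual (i := Int.negSucc 0) D m x y).symm
  | Int.negSucc (n + 1), y, x =>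
    exact (pair_ofLeftDual (i := Int.negSucc (n + 1)) D (leftIter D m n) x y).symm

theorem isAdmissible (D : Duality A) (m : BimodIso A 0 X) (hA : A.IsConnected) :
    X.IsAdmissible := fun i =>
  haveI := hA.finite_left i
  haveI := hA.finite_right i
  ⟨(iter D m i).finite_left, (iter D m i).finite_right⟩

end BimodIso

end ZAlgebra

/-! ### The structure of the noncommutative symmetric algebra in low degrees -/

namespace Snc

variable {k : Type w} [Field k] {X : CentralBimodule.{w, v} k}

namespace Comp

theorem deg1_add (i : ℤ) (x x' : (X.iter i).M) : deg1 i (x + x') = deg1 i x + deg1 i x' :=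
  Quot.sound (Rel.deg1_add i x x')

theorem deg1_lsmul (i : ℤ) (d : (X.iter i).L) (x : (X.iter i).M) :
    deg1 i (d • x) = mul (deg0 i d) (deg1 i x) :=
  Quot.sound (Rel.deg1_lsmul i d x)

theorem deg1_rsmul (i : ℤ) (r : (X.iter i).R) (x : (X.iter i).M) :
    deg1 i (MulOpposite.op r • x) = mul (deg1 i x) (deg0 (i + 1) (X.iterRL i r)) :=
  Quot.sound (Rel.deg1_rsmul i r x)

/-- The degree zero generators as an additive map. -/
def deg0Hom (i : ℤ) : (X.iter i).L →+ Comp X i i := AddMonoidHom.mk' (deg0 i) (deg0_add i)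

/-- The degree one generators as an additive map. -/
def deg1Hom (i : ℤ) : (X.iter i).M →+ Comp X i (i + 1) := AddMonoidHom.mk' (deg1 i) (deg1_add i)

theorem zero_mul {i j l : ℤ} (b : Comp X j l) : mul (0 : Comp X i j) b = 0 := X.snc.zero_mul b

theorem mul_zero {i j l : ℤ} (a : Comp X i j) : mul a (0 : Comp X j l) = 0 := X.snc.mul_zero a

/-- An induction principle for the elements of the noncommutative symmetric algebra. -/
theorem induction {P : ∀ {i j : ℤ}, Comp X i j → Prop} (h0 : ∀ i d, P (deg0 i d))
    (h1 : ∀ i x, P (deg1 i x)) (hz : ∀ i j, P (0 : Comp X i j))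
    (ha : ∀ {i j} (a b : Comp X i j), P a → P b → P (a + b))
    (hn : ∀ {i j} (a : Comp X i j), P a → P (-a))
    (hm : ∀ {i j l} (a : Comp X i j) (b : Comp X j l), P a → P b → P (mul a b))
    {i j : ℤ} (a : Comp X i j) : P a := by
  induction a using Quot.ind with
  | mk a =>
    induction a with
    | deg0 i d => exact h0 i d
    | deg1 i x => exact h1 i x
    | zero i j => exact hz i j
    | add a b iha ihb => exact ha _ _ iha ihb
    | neg a iha => exact hn _ iha
    | mul a b iha ihb => exact hm _ _ iha ihb

/-- Generators have degree zero or one, and a product of negative degree has a factor of negative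
degree. -/
theorem eq_zero_of_lt {i j : ℤ} (hij : j < i) (a : Comp X i j) : a = 0 := by
  induction a using induction with
  | h0 i d => exact absurd hij (lt_irrefl _)
  | h1 i x => omega
  | hz i j => rfl
  | ha a b iha ihb => rw [iha hij, ihb hij, add_zero]
  | hn a iha => rw [iha hij, neg_zero]
  | @hm i j l a b iha ihb =>
    rcases lt_or_ge j i with h | h
    · rw [iha h, zero_mul]
    · rw [ihb (by omega), mul_zero]

theorem sum_mul {i j l : ℤ} {ι : Type*} (s : Finset ι) (a : ι → Comp X i j) (b : Comp X j l) :
    mul (∑ t ∈ s, a t) b = ∑ t ∈ s, mul (a t) b := X.snc.sum_mul s a b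

theorem mul_sum {i j l : ℤ} {ι : Type*} (s : Finset ι) (a : Comp X i j) (b : ι → Comp X j l) :
    mul a (∑ t ∈ s, b t) = ∑ t ∈ s, mul a (b t) := X.snc.mul_sum s a b

theorem mul_neg {i j l : ℤ} (a : Comp X i j) (b : Comp X j l) : mul a (-b) = -mul a b :=
  map_neg (X.snc.mulHom i j l a) b

/-- A product of degree zero either has a factor of negative degree or has both factors of degree
zero. Heterogeneous equality keeps both indices free for the induction. -/
theorem exists_deg0 {i j : ℤ} (hij : i = j) (a : Comp X i j) : ∃ d, a ≍ deg0 (X := X) i d := by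
  induction a using induction with
  | h0 i d => exact ⟨d, HEq.rfl⟩
  | h1 i x => omega
  | hz i j => subst hij; exact ⟨0, heq_of_eq (map_zero (deg0Hom i)).symm⟩
  | ha a b iha ihb =>
    subst hij
    obtain ⟨d, hd⟩ := iha rfl
    obtain ⟨d', hd'⟩ := ihb rfl
    obtain rfl := eq_of_heq hd
    obtain rfl := eq_of_heq hd'
    exact ⟨d + d', heq_of_eq (deg0_add _ d d').symm⟩
  | hn a iha =>
    subst hij
    obtain ⟨d, hd⟩ := iha rfl
    obtain rfl := eq_of_heq hd
    exact ⟨-d, heq_of_eq (map_neg (deg0Hom _) d).symm⟩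
  | @hm i j l a b iha ihb =>
    subst hij
    rcases lt_trichotomy j i with h | rfl | h
    · refine ⟨0, heq_of_eq ?_⟩
      rw [eq_zero_of_lt h a, zero_mul]
      exact (map_zero (deg0Hom i)).symm
    · obtain ⟨d, hd⟩ := iha rfl
      obtain ⟨d', hd'⟩ := ihb rfl
      obtain rfl := eq_of_heq hd
      obtain rfl := eq_of_heq hd'
      exact ⟨d * d', heq_of_eq (deg0_mul _ d d').symm⟩
    · refine ⟨0, heq_of_eq ?_⟩
      rw [eq_zero_of_lt h b, mul_zero]
      exact (map_zero (deg0Hom i)).symm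

theorem deg0_surjective (i : ℤ) : Function.Surjective (deg0 (X := X) i) := fun a => by
  obtain ⟨d, h⟩ := exists_deg0 rfl a
  exact ⟨d, (eq_of_heq h).symm⟩

theorem iterRL_surjective (i : ℤ) : Function.Surjective (X.iterRL i) := by
  match i with
  | Int.ofNat n => exact Function.surjective_id
  | Int.negSucc 0 => exact Function.surjective_id
  | Int.negSucc (n + 1) => exact Function.surjective_id

/-- A nonzero product of degree one has factors of degrees zero and one, and the bimodule relations
absorb the former into the latter. -/
theorem exists_deg1 {i j : ℤ} (hij : i + 1 = j) (a : Comp X i j) :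
    ∃ x, a ≍ deg1 (X := X) i x := by
  induction a using induction with
  | h0 i d => omega
  | h1 i x => exact ⟨x, HEq.rfl⟩
  | hz i j => subst hij; exact ⟨0, heq_of_eq (map_zero (deg1Hom i)).symm⟩
  | ha a b iha ihb =>
    subst hij
    obtain ⟨d, hd⟩ := iha rfl
    obtain ⟨d', hd'⟩ := ihb rfl
    obtain rfl := eq_of_heq hd
    obtain rfl := eq_of_heq hd'
    exact ⟨d + d', heq_of_eq (deg1_add _ d d').symm⟩
  | hn a iha =>
    subst hij
    obtain ⟨d, hd⟩ := iha rfl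
    obtain rfl := eq_of_heq hd
    exact ⟨-d, heq_of_eq (map_neg (deg1Hom _) d).symm⟩
  | @hm i j l a b iha ihb =>
    subst hij
    have hz : (0 : Comp X i (i + 1)) = deg1 i 0 := (map_zero (deg1Hom i)).symm
    rcases lt_trichotomy j i with h | rfl | h
    · exact ⟨0, heq_of_eq (by rw [eq_zero_of_lt h a, zero_mul, hz])⟩
    · obtain ⟨d, rfl⟩ := deg0_surjective j a
      obtain ⟨x, hx⟩ := ihb rfl
      obtain rfl := eq_of_heq hx
      exact ⟨d • x, heq_of_eq (deg1_lsmul _ d x).symm⟩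
    · rcases (show i + 1 ≤ j from h).eq_or_lt with rfl | h
      · obtain ⟨x, hx⟩ := iha rfl
        obtain rfl := eq_of_heq hx
        obtain ⟨d, rfl⟩ := deg0_surjective _ b
        obtain ⟨r, rfl⟩ := iterRL_surjective i d
        exact ⟨MulOpposite.op r • x, heq_of_eq (deg1_rsmul _ r x).symm⟩
      · exact ⟨0, heq_of_eq (by rw [eq_zero_of_lt h b, mul_zero, hz])⟩

theorem deg1_surjective (i : ℤ) : Function.Surjective (deg1 (X := X) i) := fun a => by
  obtain ⟨d, h⟩ := exists_deg1 rfl a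
  exact ⟨d, (eq_of_heq h).symm⟩

/-- Elements of positive degree are right combinations of generators of `M^{i*}`. -/
theorem exists_eq_sum {r : ℤ → ℕ} {x : ∀ i, Fin (r i) → (X.iter i).M}
    (hx : ∀ i, Submodule.span (X.iter i).Rᵐᵒᵖ (Set.range (x i)) = ⊤) {i n : ℤ} (a : Comp X i n)
    (hn : i < n) :
    ∃ c : Fin (r i) → Comp X (i + 1) n, a = ∑ s, mul (deg1 i (x i s)) (c s) := by
  have h1 : ∀ i (z : (X.iter i).M), ∃ c : Fin (r i) → Comp X (i + 1) (i + 1),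
      deg1 i z = ∑ s, mul (deg1 i (x i s)) (c s) := fun i z => by
    have hz : z ∈ Submodule.span (X.iter i).Rᵐᵒᵖ (Set.range (x i)) := hx i ▸ Submodule.mem_top
    obtain ⟨c, rfl⟩ := (Submodule.mem_span_range_iff_exists_fun _).1 hz
    refine ⟨fun s => deg0 (i + 1) (X.iterRL i (c s).unop), ?_⟩
    refine (map_sum (deg1Hom i) _ _).trans (Finset.sum_congr rfl fun s _ => ?_)
    exact deg1_rsmul i (c s).unop (x i s)
  induction a using induction with
  | h0 i d => exact absurd hn (lt_irrefl _)
  | h1 i z => exact h1 i z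
  | hz i n => exact ⟨0, (Finset.sum_eq_zero fun s _ => mul_zero _).symm⟩
  | ha a b iha ihb =>
    obtain ⟨c, rfl⟩ := iha hn
    obtain ⟨c', rfl⟩ := ihb hn
    exact ⟨c + c', by simp only [Pi.add_apply, mul_add, Finset.sum_add_distrib]⟩
  | hn a iha =>
    obtain ⟨c, rfl⟩ := iha hn
    exact ⟨-c, by simp only [Pi.neg_apply, mul_neg, Finset.sum_neg_distrib]⟩
  | @hm i l n a b iha ihb =>
    rcases lt_trichotomy l i with h | rfl | h
    · refine ⟨0, ?_⟩
      rw [eq_zero_of_lt h a, zero_mul]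
      exact (Finset.sum_eq_zero fun s _ => mul_zero _).symm
    -- A left factor of degree zero turns the generators into `d • x_s`, which are expanded again in
    -- the `x_t`.
    · obtain ⟨d, rfl⟩ := deg0_surjective l a
      obtain ⟨c, rfl⟩ := ihb hn
      choose e he using fun s => h1 l (d • x l s)
      refine ⟨fun t => ∑ s, mul (e s t) (c s), ?_⟩
      simp only [mul_sum, ← mul_assoc]
      rw [Finset.sum_comm]
      refine Finset.sum_congr rfl fun s _ => ?_
      rw [← deg1_lsmul, he, sum_mul]
    · obtain ⟨c, rfl⟩ := iha h
      exact ⟨fun s => mul (c s) b, by simp only [sum_mul, mul_assoc]⟩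

end Comp

end Snc

/-! ### Homomorphisms from the noncommutative symmetric algebra -/

namespace ZAlgebra

variable {k : Type w} [Field k] {A : ZAlgebra.{w, v} k}

/-- One step of generation implies that tails are finitely generated. -/
theorem hasFiniteTails_of_step (h : ∀ i : ℤ, ∃ (r : ℕ) (x : Fin r → A.comp i (i + 1)) (N' : ℤ),
    ∀ n : ℤ, N' ≤ n → ∀ a : A.comp i n, ∃ c : Fin r → A.comp (i + 1) n,
      a = ∑ s, A.mul (x s) (c s)) : A.HasFiniteTails := by
  intro i N hN
  induction N, hN using Int.leInduction with
  | base => exact ⟨1, fun _ => A.one i, i, fun n _ a => ⟨fun _ => a, by simp [A.one_mul]⟩⟩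
  | succ N hN ih =>
    obtain ⟨r, g, N₁, hg⟩ := ih
    obtain ⟨r', x, N₂, hx⟩ := h N
    -- The products `g_s x_t` generate the tail one degree further.
    let e := finProdFinEquiv (m := r) (n := r')
    refine ⟨r * r', fun s => A.mul (g (e.symm s).1) (x (e.symm s).2), max N₁ N₂,
      fun n hn a => ?_⟩
    simp only [max_le_iff] at hn
    obtain ⟨c, rfl⟩ := hg n hn.1 a
    choose c' hc' using fun s => hx n hn.2 (c s)
    refine ⟨fun s => c' (e.symm s).1 (e.symm s).2, ?_⟩
    rw [e.symm.sum_comp (fun p => A.mul (A.mul (g p.1) (x p.2)) (c' p.1 p.2)),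
      Fintype.sum_prod_type]
    refine Finset.sum_congr rfl fun s _ => ?_
    rw [hc' s, A.mul_sum]
    simp only [A.mul_assoc]

/-! ### The homomorphism determined by a duality -/

namespace BimodIso

variable {X : CentralBimodule.{w, v} k} (D : Duality A) (m : BimodIso A 0 X)

/-- The value of an expression in the generators. -/
noncomputable def eval : ∀ {i j : ℤ}, Snc.Pre X i j → A.comp i j
  | _, _, .deg0 i d => (iter D m i).left d
  | _, _, .deg1 i x => (iter D m i).mid x
  | _, _, .zero _ _ => 0
  | _, _, .add a b => eval a + eval b
  | _, _, .neg a => -eval a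
  | _, _, .mul a b => A.mul (eval a) (eval b)

theorem eval_sum {i j : ℤ} {n : ℕ} (f : Fin n → Snc.Pre X i j) :
    eval D m (Snc.Pre.sum f) = ∑ a, eval D m (f a) := by
  have : ∀ l : List (Snc.Pre X i j), eval D m (l.foldr Snc.Pre.add (Snc.Pre.zero i j)) =
      (l.map (eval D m)).sum := fun l => by
    induction l with
    | nil => rfl
    | cons a l ih =>
      rw [List.map_cons, List.sum_cons, ← ih]
      rfl
  rw [Snc.Pre.sum, this, List.map_ofFn, List.sum_ofFn]
  rfl

theorem eval_rel {i j : ℤ} {a b : Snc.Pre X i j} (h : Snc.Rel X a b) :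
    eval D m a = eval D m b := by
  induction h with
  | add_assoc a b c => exact add_assoc _ _ _
  | add_comm a b => exact add_comm _ _
  | zero_add a => exact zero_add _
  | neg_add a => exact neg_add_cancel _
  | mul_assoc a b c => exact A.mul_assoc _ _ _
  | one_mul a =>
    change A.mul ((iter D m _).left 1) _ = _
    rw [map_one]
    exact A.one_mul _
  | mul_one a =>
    change A.mul _ ((iter D m _).left 1) = _
    rw [map_one]
    exact A.mul_one _
  | add_mul a b c => exact A.add_mul _ _ _
  | mul_add a b c => exact A.mul_add _ _ _
  | central c a =>
    change A.mul ((iter D m _).left _) (eval D m a) = A.mul (eval D m a) ((iter D m _).left _)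
    rw [left_algebraMap, left_algebraMap, one_smul_mul, mul_smul_one]
  | add_left b _ ih => exact congrArg (· + eval D m b) ih
  | add_right a _ ih => exact congrArg (eval D m a + ·) ih
  | neg _ ih => exact congrArg (-·) ih
  | mul_left b _ ih => exact congrArg (A.mul · (eval D m b)) ih
  | mul_right a _ ih => exact congrArg (A.mul (eval D m a)) ih
  | deg0_add i d d' => exact map_add (iter D m i).left d d'
  | deg0_mul i d d' => exact map_mul (iter D m i).left d d'
  | deg1_add i x x' => exact map_add (iter D m i).mid x x'
  | deg1_lsmul i d x => exact (iter D m i).mid_lsmul d x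
  | deg1_rsmul i r x =>
    refine ((iter D m i).mid_rsmul r x).trans ?_
    rw [← iter_left_iterRL]
    rfl
  -- The identifications preserve pairings, so dual bases go to dual bases, on which the product in
  -- `A` vanishes by `D.unit`.
  | unit i n x y h =>
    rw [eval_sum]
    refine D.unit i n (fun a => (iter D m i).mid (x a)) (fun a => (iter D m (i + 1)).mid (y a))
      fun z => ?_
    obtain ⟨z, rfl⟩ := (iter D m (i + 1)).mid.surjective z
    conv_rhs => rw [← h z, map_sum]
    refine Finset.sum_congr rfl fun a _ => ?_
    rw [mid_lsmul, iter_left_iterPair]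

/-- The homomorphism from the noncommutative symmetric algebra determined by a duality. -/
noncomputable def hom : X.snc.Hom A where
  map i j :=
    { toFun := Quot.lift (eval D m) (fun _ _ h => eval_rel D m h)
      map_add' := by
        rintro ⟨a⟩ ⟨b⟩
        rfl
      map_smul' := by
        rintro c ⟨a⟩
        change A.mul ((iter D m i).left (algebraMap k _ c)) (eval D m a) = c • eval D m a
        rw [left_algebraMap, one_smul_mul] }
  map_one i := map_one (iter D m i).left
  map_mul := by
    rintro i j l ⟨a⟩ ⟨b⟩
    rfl

theorem hom_deg0 (i : ℤ) (d : (X.iter i).L) :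
    (hom D m).map i i (Snc.Comp.deg0 i d) = (iter D m i).left d := rfl

theorem hom_deg1 (i : ℤ) (x : (X.iter i).M) :
    (hom D m).map i (i + 1) (Snc.Comp.deg1 i x) = (iter D m i).mid x := rfl

/-- The generators surject onto the component and their composite to `A i i` is an isomorphism, so
no collapse can occur. -/
theorem hom_bijective_deg0 (i : ℤ) : Function.Bijective ((hom D m).map i i) := by
  refine ⟨fun a b h => ?_, fun a => ?_⟩
  · obtain ⟨d, rfl⟩ := Snc.Comp.deg0_surjective i a
    obtain ⟨d', rfl⟩ := Snc.Comp.deg0_surjective i b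
    rw [hom_deg0, hom_deg0] at h
    rw [(iter D m i).left.injective h]
  · obtain ⟨d, rfl⟩ := (iter D m i).left.surjective a
    exact ⟨_, hom_deg0 D m i d⟩

theorem hom_bijective_deg1 (i : ℤ) : Function.Bijective ((hom D m).map i (i + 1)) := by
  refine ⟨fun a b h => ?_, fun a => ?_⟩
  · obtain ⟨d, rfl⟩ := Snc.Comp.deg1_surjective i a
    obtain ⟨d', rfl⟩ := Snc.Comp.deg1_surjective i b
    rw [hom_deg1, hom_deg1] at h
    rw [(iter D m i).mid.injective h]
  · obtain ⟨d, rfl⟩ := (iter D m i).mid.surjective a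
    exact ⟨_, hom_deg1 D m i d⟩

theorem hom_ext {φ φ' : X.snc.Hom A}
    (h0 : ∀ i d, φ.map i i (Snc.Comp.deg0 i d) = φ'.map i i (Snc.Comp.deg0 i d))
    (h1 : ∀ i x, φ.map i (i + 1) (Snc.Comp.deg1 i x) = φ'.map i (i + 1) (Snc.Comp.deg1 i x)) :
    φ = φ' := by
  have key : ∀ i j (a : Snc.Comp X i j), φ.map i j a = φ'.map i j a := fun i j a => by
    induction a using Snc.Comp.induction with
    | h0 i d => exact h0 i d
    | h1 i x => exact h1 i x
    | hz i j => exact (map_zero (φ.map i j)).trans (map_zero (φ'.map i j)).symm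
    | @ha i j a b iha ihb =>
      exact (map_add (φ.map i j) a b).trans
        ((congrArg₂ (· + ·) iha ihb).trans (map_add (φ'.map i j) a b).symm)
    | @hn i j a iha =>
      exact (map_neg (φ.map i j) a).trans
        ((congrArg (-·) iha).trans (map_neg (φ'.map i j) a).symm)
    | hm a b iha ihb =>
      exact (φ.map_mul a b).trans
        ((congrArg₂ A.mul iha ihb).trans (φ'.map_mul a b).symm)
  cases φ
  cases φ'
  congr
  funext i j
  exact LinearMap.ext (key i j)

/-- The uniqueness of the homomorphism determined by a duality. -/
theorem hom_unique (φ : X.snc.Hom A)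
    (h0 : ∀ d, φ.map 0 0 (Snc.Comp.deg0 0 d) = (iter D m 0).left d)
    (h0' : ∀ d, φ.map 1 1 (Snc.Comp.deg0 1 d) = (iter D m 1).left d)
    (h1 : ∀ x, φ.map 0 1 (Snc.Comp.deg1 0 x) = (iter D m 0).mid x)
    (hp : ∀ (i : ℤ) (x : (X.iter i).M) (y : (X.iter (i + 1)).M),
      φ.map (i + 1) (i + 1) (Snc.Comp.deg0 (i + 1) (X.iterPair i y x)) =
        D.pair i (φ.map (i + 1) (i + 1 + 1) (Snc.Comp.deg1 (i + 1) y))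
          (φ.map i (i + 1) (Snc.Comp.deg1 i x))) :
    φ = hom D m := by
  let S : ℤ → Prop := fun i => (∀ d, φ.map i i (Snc.Comp.deg0 i d) = (iter D m i).left d) ∧
    (∀ d, φ.map (i + 1) (i + 1) (Snc.Comp.deg0 (i + 1) d) = (iter D m (i + 1)).left d) ∧
    ∀ x, φ.map i (i + 1) (Snc.Comp.deg1 i x) = (iter D m i).mid x
  -- Pairing against the known values on `M^{i*}` determines the values on `M^{(i+1)*}`; right
  -- faithfulness then determines those on the next ring.
  have up : ∀ i, S i → S (i + 1) := by
    rintro i ⟨_, hd, hx⟩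
    have hy : ∀ y, φ.map (i + 1) (i + 1 + 1) (Snc.Comp.deg1 (i + 1) y) =
        (iter D m (i + 1)).mid y := fun y => D.pair_ext_left i _ _ fun x => by
      obtain ⟨x, rfl⟩ := (iter D m i).mid.surjective x
      rw [← iter_left_iterPair, ← hd, hp, hx]
    refine ⟨hd, fun r => D.right_faithful (i + 1) _ _ fun y => ?_, hy⟩
    obtain ⟨y, rfl⟩ := (iter D m (i + 1)).mid.surjective y
    obtain ⟨r, rfl⟩ := Snc.Comp.iterRL_surjective (i + 1) r
    rw [iter_left_iterRL, ← mid_rsmul, ← hy, ← hy, Snc.Comp.deg1_rsmul]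
    exact (φ.map_mul _ _).symm
  -- The mirror argument, by nondegeneracy in the other variable and left faithfulness.
  have down : ∀ i, S (i + 1) → S i := by
    rintro i ⟨hd, _, hy⟩
    have hx : ∀ x, φ.map i (i + 1) (Snc.Comp.deg1 i x) = (iter D m i).mid x := fun x =>
      D.pair_ext i _ _ fun y => by
        obtain ⟨y, rfl⟩ := (iter D m (i + 1)).mid.surjective y
        rw [← iter_left_iterPair, ← hd, hp, hy]
    refine ⟨fun d => D.left_faithful i _ _ fun x => ?_, hd, hx⟩
    obtain ⟨x, rfl⟩ := (iter D m i).mid.surjective x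
    rw [← mid_lsmul, ← hx, ← hx, Snc.Comp.deg1_lsmul]
    exact (φ.map_mul _ _).symm
  have hS : ∀ i, S i := fun i => by
    induction i using Int.induction_on with
    | zero => exact ⟨h0, h0', h1⟩
    | succ i ih => exact up _ ih
    | pred i ih => exact down _ (by rwa [sub_add_cancel])
  exact hom_ext (fun i d => (hS i).1 d) (fun i x => (hS i).2.2 x)

end BimodIso

/-- The noncommutative symmetric algebra of an admissible bimodule has finitely generated tails. -/
theorem hasFiniteTails_snc {X : CentralBimodule.{w, v} k} (hX : X.IsAdmissible) :
    X.snc.HasFiniteTails := by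
  have h : ∀ i, ∃ (r : ℕ) (x : Fin r → (X.iter i).M),
      Submodule.span (X.iter i).Rᵐᵒᵖ (Set.range x) = ⊤ := fun i => by
    have := (hX i).2
    exact Module.Finite.exists_fin
  choose r x hx using h
  exact hasFiniteTails_of_step fun i => ⟨r i, fun s => Snc.Comp.deg1 i (x i s), i + 1,
    fun n hn a => Snc.Comp.exists_eq_sum hx a hn⟩

end ZAlgebra

/-! ### Euler sequences -/

section Euler

variable {C : Type u} [Category.{v} C] [Abelian C] {X Y Z : C}

/-- Evaluate at `z` and expand `z` in the `x_a`. -/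
theorem HomDual.eq_sum {n : ℕ} {x : Fin n → (X ⟶ Y)} {ψ : Fin n → HomDual X Y}
    (hx : ∀ z : X ⟶ Y, ∑ a, ψ a z • x a = z) (θ : HomDual X Y) :
    ∑ a, MulOpposite.op (θ (x a)) • ψ a = θ := by
  refine LinearMap.ext fun z => ?_
  conv_rhs => rw [← hx z, map_sum]
  rw [LinearMap.sum_apply]
  exact Finset.sum_congr rfl fun a _ => (map_smul θ _ _).symm

namespace DualTensor

variable (T : DualTensor X Y)

/-- The canonical morphism does not depend on the dual bases. -/
theorem sum_tmul_eq {n n' : ℕ} {x : Fin n → (X ⟶ Y)} {ψ : Fin n → HomDual X Y}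
    {x' : Fin n' → (X ⟶ Y)} {ψ' : Fin n' → HomDual X Y}
    (hx : ∀ z : X ⟶ Y, ∑ a, ψ a z • x a = z) (hx' : ∀ z : X ⟶ Y, ∑ a, ψ' a z • x' a = z) :
    ∑ a, x a ≫ T.tmul (ψ a) = ∑ a, x' a ≫ T.tmul (ψ' a) := by
  have h1 : ∀ a, x a ≫ T.tmul (ψ a) =
      ∑ b, x' b ≫ T.tmul (MulOpposite.op (ψ' b (x a)) • ψ a) := fun a => by
    conv_lhs => rw [← hx' (x a), Preadditive.sum_comp]
    refine Finset.sum_congr rfl fun b _ => ?_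
    rw [T.tmul_smul]
    exact Category.assoc _ _ _
  rw [Finset.sum_congr rfl fun a _ => h1 a, Finset.sum_comm]
  refine Finset.sum_congr rfl fun b _ => ?_
  rw [← Preadditive.comp_sum, ← T.tmul_sum, HomDual.eq_sum hx]

theorem hom_ext {Z : C} {f g : T.obj ⟶ Z} (h : ∀ ψ, T.tmul ψ ≫ f = T.tmul ψ ≫ g) : f = g :=
  (T.universal Z (fun ψ => T.tmul ψ ≫ g)
    (fun ψ ψ' => by rw [T.tmul_add, Preadditive.add_comp])
    (fun d ψ => by rw [T.tmul_smul, Category.assoc])).unique h fun _ => rfl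

/-- The morphism `*Hom(X, Y) ⊗_D Y ⟶ Y` given by evaluation at `x : X ⟶ Y`. -/
theorem exists_eval (x : X ⟶ Y) : ∃ π : T.obj ⟶ Y, ∀ ψ, T.tmul ψ ≫ π = ψ x :=
  (T.universal Y (fun ψ => ψ x) (fun _ _ => rfl) (fun _ _ => rfl)).exists

/-- Morphisms to `*Hom(X, Y) ⊗_D Y` are sums of morphisms factoring through `Y`. -/
theorem exists_eq_sum {n : ℕ} {x : Fin n → (X ⟶ Y)} {ψ : Fin n → HomDual X Y}
    (hx : ∀ z : X ⟶ Y, ∑ a, ψ a z • x a = z) {W : C} (g : W ⟶ T.obj) :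
    ∃ c : Fin n → (W ⟶ Y), g = ∑ a, c a ≫ T.tmul (ψ a) := by
  choose π hπ using fun a => T.exists_eval (x a)
  refine ⟨fun a => g ≫ π a, ?_⟩
  -- The identity factors through a finite sum of copies of `Y`: project by evaluation at `x_a`,
  -- include by `ψ_a ⊗ -`.
  have h : 𝟙 T.obj = ∑ a, π a ≫ T.tmul (ψ a) := T.hom_ext fun θ => by
    rw [Category.comp_id, Preadditive.comp_sum]
    conv_lhs => rw [← HomDual.eq_sum hx θ, T.tmul_sum]
    refine Finset.sum_congr rfl fun a _ => ?_
    rw [T.tmul_smul, ← Category.assoc, hπ]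
  conv_lhs => rw [← Category.comp_id g, h, Preadditive.comp_sum]
  simp only [Category.assoc]

end DualTensor

namespace EulerSequence

variable (S : EulerSequence X Y Z)

theorem p_Φ (f : End X) : S.p ≫ S.Φ f = S.act f ≫ S.p :=
  haveI := S.shortExact.epi_g
  S.shortExact.exact.g_desc _ _

theorem dualToHom_add (ψ ψ' : HomDual X Y) :
    S.dualToHom (ψ + ψ') = S.dualToHom ψ + S.dualToHom ψ' := by
  simp only [dualToHom, S.tmul_add, Preadditive.add_comp]

theorem dualToHom_op_smul (d : End Y) (ψ : HomDual X Y) :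
    S.dualToHom (MulOpposite.op d • ψ) = d ≫ S.dualToHom ψ := by
  simp only [dualToHom, S.tmul_smul, Category.assoc]

theorem dualToHom_precomp (f : End X) (ψ : HomDual X Y) :
    S.dualToHom (ψ.precomp f) = S.dualToHom ψ ≫ S.Φ f := by
  simp only [dualToHom, Category.assoc, p_Φ]
  rw [← Category.assoc, S.tmul_act]

/-- The sum is `η ≫ p`, since `η` may be computed with any dual bases. -/
theorem sum_comp_dualToHom {n : ℕ} {x : Fin n → (X ⟶ Y)} {ψ : Fin n → HomDual X Y}
    (hx : ∀ z : X ⟶ Y, ∑ a, ψ a z • x a = z) : ∑ a, x a ≫ S.dualToHom (ψ a) = 0 := by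
  obtain ⟨n', x', ψ', hx', hη⟩ := S.isCanonical
  have h := S.sum_tmul_eq hx hx'
  rw [← hη] at h
  simp only [dualToHom, ← Category.assoc]
  rw [← Preadditive.sum_comp, h, S.zero]

/-- Otherwise the monomorphism `η`, a sum of maps factoring through morphisms `X ⟶ Y`, would be
zero. -/
theorem exists_ne_zero (S : EulerSequence X Y Z) (hX : ¬ IsZero X) : ∃ f : X ⟶ Y, f ≠ 0 := by
  by_contra! h
  obtain ⟨n, x, ψ, -, hη⟩ := S.isCanonical
  have h0 : S.η = 0 := by
    rw [hη]
    exact Finset.sum_eq_zero fun a _ => by rw [h (x a), zero_comp]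
  have := S.shortExact.mono_f
  exact hX (IsZero.of_mono_eq_zero S.η h0)

/-- Morphisms to `Z` lift to `*Hom(X, Y) ⊗_D Y` if `Ext¹(W, X)` vanishes. -/
theorem exists_lift [HasExt.{w'} C] {W : C} [Subsingleton (Abelian.Ext W X 1)] (f : W ⟶ Z) :
    ∃ g : W ⟶ S.obj, g ≫ S.p = f := by
  obtain ⟨x, hx⟩ := Abelian.Ext.covariant_sequence_exact₃ W S.shortExact
    (Abelian.Ext.mk₀ f) (zero_add 1) (Subsingleton.elim (α := Abelian.Ext W X 1) _ _)
  obtain ⟨g, rfl⟩ := (Abelian.Ext.mk₀_bijective W S.obj).surjective x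
  refine ⟨g, (Abelian.Ext.mk₀_bijective W Z).injective ?_⟩
  rw [← hx]
  exact (Abelian.Ext.mk₀_comp_mk₀ g S.p).symm

end EulerSequence

end Euler

/-! ### The orbit algebra of a helix -/

namespace Helix

variable {k : Type w} [Field k] {C : Type u} [Category.{v} C] [Abelian C] [Linear k C]
  (H : Helix C)

theorem finite_left' {a b : ℤ} (h : a + 1 = b) :
    Module.Finite (End (H.obj b)) (H.obj a ⟶ H.obj b) := by
  subst h
  exact H.finite_left a

theorem finite_right' {a b : ℤ} (h : a + 1 = b) :
    Module.Finite (End (H.obj a))ᵐᵒᵖ (H.obj a ⟶ H.obj b) := by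
  subst h
  exact H.finite_right a

variable (k) in
theorem isConnected_orbitAlgebra (hHom : ∀ i j : ℤ, i < j → ∀ f : H.obj j ⟶ H.obj i, f = 0) :
    (orbitAlgebra k H.obj).IsConnected where
  positive i j hij := ⟨fun f g => (hHom (-i) (-j) (by omega) f).trans
    (hHom (-i) (-j) (by omega) g).symm⟩
  division i := H.division (-i)
  finite_left i := H.finite_left' (a := -(i + 1)) (b := -i) (by omega)
  finite_right i := H.finite_right' (a := -(i + 1)) (b := -i) (by omega)

theorem not_isZero (i : ℤ) : ¬ IsZero (H.obj i) := fun h =>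
  have := (H.division i).1
  one_ne_zero (α := End (H.obj i)) (h.eq_of_src _ _)

theorem exists_ne_zero {a b : ℤ} (h : a + 1 = b) : ∃ f : H.obj a ⟶ H.obj b, f ≠ 0 :=
  (H.euler a b (a + 2) h rfl).exists_ne_zero (H.not_isZero a)

/-- In a division ring a nonzero `d - d'` is invertible and cannot annihilate a nonzero `x`. -/
theorem eq_of_comp_left {a b : ℤ} (h : a + 1 = b) (d d' : End (H.obj a))
    (hd : ∀ x : H.obj a ⟶ H.obj b, d ≫ x = d' ≫ x) : d = d' := by
  obtain ⟨x, hx⟩ := H.exists_ne_zero h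
  by_contra hne
  obtain ⟨e, he⟩ := (H.division a).2 (d - d') (sub_ne_zero.2 hne)
  have h1 : (↑e⁻¹ : End (H.obj a)) ≫ (d - d' : H.obj a ⟶ H.obj a) = 𝟙 _ := by
    rw [← he]
    exact e.mul_inv
  refine hx ?_
  rw [← Category.id_comp x, ← h1, Category.assoc, Preadditive.sub_comp, hd, sub_self, comp_zero]

theorem eq_of_comp_right {a b : ℤ} (h : a + 1 = b) (d d' : End (H.obj b))
    (hd : ∀ x : H.obj a ⟶ H.obj b, x ≫ d = x ≫ d') : d = d' := by
  obtain ⟨x, hx⟩ := H.exists_ne_zero h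
  by_contra hne
  obtain ⟨e, he⟩ := (H.division b).2 (d - d') (sub_ne_zero.2 hne)
  have h1 : (d - d' : H.obj b ⟶ H.obj b) ≫ (↑e⁻¹ : End (H.obj b)) = 𝟙 _ := by
    rw [← he]
    exact e.inv_mul
  refine hx ?_
  rw [← Category.comp_id x, ← h1, ← Category.assoc, Preadditive.comp_sub, hd, sub_self, zero_comp]

/-- The Euler sequence linking `B (i+1) (i+2)` and `B i (i+1)`. -/
abbrev eulerAt (i : ℤ) : EulerSequence (H.obj (-(i + 1 + 1))) (H.obj (-(i + 1))) (H.obj (-i)) :=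
  H.euler (-(i + 1 + 1)) (-(i + 1)) (-i) (by ring) (by ring)

/-- The identification of `B i (i+1)` with the left dual of `B (i+1) (i+2)`. -/
noncomputable def dualEquiv (i : ℤ) : HomDual (H.obj (-(i + 1 + 1))) (H.obj (-(i + 1))) ≃
    (H.obj (-(i + 1)) ⟶ H.obj (-i)) :=
  Equiv.ofBijective _ (H.bijective_dualToHom (-(i + 1 + 1)) (-(i + 1)) (-i) (by ring) (by ring))

theorem dualEquiv_apply (i : ℤ) (ψ) : H.dualEquiv i ψ = (H.eulerAt i).dualToHom ψ := rfl

theorem dualToHom_dualEquiv_symm (i : ℤ) (x : H.obj (-(i + 1)) ⟶ H.obj (-i)) :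
    (H.eulerAt i).dualToHom ((H.dualEquiv i).symm x) = x :=
  (H.dualEquiv i).apply_symm_apply x

theorem dualEquiv_symm_add (i : ℤ) (x x' : H.obj (-(i + 1)) ⟶ H.obj (-i)) :
    (H.dualEquiv i).symm (x + x') = (H.dualEquiv i).symm x + (H.dualEquiv i).symm x' := by
  rw [Equiv.symm_apply_eq, dualEquiv_apply, EulerSequence.dualToHom_add,
    dualToHom_dualEquiv_symm, dualToHom_dualEquiv_symm]

theorem dualEquiv_symm_comp (i : ℤ) (x : H.obj (-(i + 1)) ⟶ H.obj (-i))
    (d : End (H.obj (-(i + 1)))) :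
    (H.dualEquiv i).symm (d ≫ x) = MulOpposite.op d • (H.dualEquiv i).symm x := by
  rw [Equiv.symm_apply_eq, dualEquiv_apply, EulerSequence.dualToHom_op_smul,
    dualToHom_dualEquiv_symm]

theorem dualEquiv_symm_comp_Φ (i : ℤ) (x : H.obj (-(i + 1)) ⟶ H.obj (-i))
    (f : End (H.obj (-(i + 1 + 1)))) :
    (H.dualEquiv i).symm (x ≫ (H.eulerAt i).Φ f) = ((H.dualEquiv i).symm x).precomp f := by
  rw [Equiv.symm_apply_eq, dualEquiv_apply, EulerSequence.dualToHom_precomp,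
    dualToHom_dualEquiv_symm]

variable (k) in
/-- The duality on the orbit algebra of a helix. -/
noncomputable def duality : (orbitAlgebra k H.obj).Duality where
  pair i y x := (H.dualEquiv i).symm x y
  add_pair i y y' x := map_add ((H.dualEquiv i).symm x) y y'
  pair_add i y x x' := LinearMap.congr_fun (H.dualEquiv_symm_add i x x') y
  mul_pair i d y x := ((H.dualEquiv i).symm x).map_smul (show End (H.obj (-(i + 1))) from d) y
  pair_mul i y x d := LinearMap.congr_fun (H.dualEquiv_symm_comp i x d) y
  twist i r := (H.eulerAt i).Φ r
  twist_bijective i := H.bijective_Φ _ _ _ _ _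
  pair_twist i y r x := (LinearMap.congr_fun (H.dualEquiv_symm_comp_Φ i x r) y).symm
  pair_ext i x x' h := (H.dualEquiv i).symm.injective (LinearMap.ext h)
  -- The dual bases defining `η`, with `ψ_a` regarded as an element of `B i (i+1)` and `x_a` as one
  -- of `B (i+1) (i+2)`.
  exists_basis i := by
    obtain ⟨n, x, ψ, hx, -⟩ := (H.eulerAt i).isCanonical
    refine ⟨n, fun a => (H.eulerAt i).dualToHom (ψ a), x, fun z => ?_⟩
    refine Eq.trans (Finset.sum_congr rfl fun a _ => ?_) (hx z)
    exact congrArg (fun θ : HomDual _ _ => θ z • x a) ((H.dualEquiv i).symm_apply_apply (ψ a))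
  unit i n x y h := by
    have h' := (H.eulerAt i).sum_comp_dualToHom (x := y)
      (ψ := fun a => (H.dualEquiv i).symm (x a)) h
    exact Eq.trans (Finset.sum_congr rfl fun a _ => congrArg (fun f => CategoryStruct.comp (y a) f)
      (H.dualToHom_dualEquiv_symm i (x a)).symm) h'
  left_faithful i d d' h := H.eq_of_comp_right (a := -(i + 1)) (b := -i) (by omega) d d' h
  right_faithful i d d' h := H.eq_of_comp_left (a := -(i + 1)) (b := -i) (by omega) d d' h

variable (k) in
/-- `Hom(ℒ_{-1}, ℒ_0)` is the component `B 0 1` of the orbit algebra. -/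
def bimodIso : ZAlgebra.BimodIso (orbitAlgebra k H.obj) 0 (homBimod k (H.obj (-1)) (H.obj 0)) where
  left := RingEquiv.refl (End (H.obj 0))
  right := RingEquiv.refl (End (H.obj (-1)))
  mid := AddEquiv.refl (H.obj (-1) ⟶ H.obj 0)
  mid_lsmul _ _ := rfl
  mid_rsmul _ _ := rfl
  left_algebraMap c := Algebra.algebraMap_eq_smul_one (A := End (H.obj 0)) c
  right_algebraMap c := Algebra.algebraMap_eq_smul_one (A := End (H.obj (-1))) c

variable (k) in
/-- The orbit algebra has finitely generated tails. -/
theorem hasFiniteTails_orbitAlgebra [HasExt.{w'} C] (n : ℕ)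
    (hExt : ∀ l : ℤ, (n : ℤ) ≤ l → ∀ i : ℤ,
      Subsingleton (Abelian.Ext (H.obj i) (H.obj (i + l)) 1)) :
    (orbitAlgebra k H.obj).HasFiniteTails := by
  refine ZAlgebra.hasFiniteTails_of_step fun i => ?_
  obtain ⟨r, x, ψ, hx, -⟩ := (H.eulerAt i).isCanonical
  -- The kernel term is `ℒ_{-(i+2)}` and the source `ℒ_{-j}`, so the relevant gap is `j - i - 2`,
  -- which must be at least `n`.
  refine ⟨r, fun s => (H.eulerAt i).dualToHom (ψ s), i + n + 2, fun j hj f => ?_⟩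
  have : Subsingleton (Abelian.Ext (H.obj (-j)) (H.obj (-(i + 1 + 1))) 1) := by
    have h := hExt (j - i - 2) (by omega) (-j)
    rwa [show -j + (j - i - 2) = -(i + 1 + 1) by ring] at h
  obtain ⟨g, hg⟩ := (H.eulerAt i).exists_lift f
  obtain ⟨c, hc⟩ := (H.eulerAt i).exists_eq_sum hx g
  refine ⟨c, ?_⟩
  rw [← hg, hc, Preadditive.sum_comp]
  exact Finset.sum_congr rfl fun s _ => Category.assoc _ _ _

variable (k) in
/-- The canonical homomorphism from the noncommutative symmetric algebra to the orbit algebra. -/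
noncomputable def canonicalHom :
    (homBimod k (H.obj (-1)) (H.obj 0)).snc.Hom (orbitAlgebra k H.obj) :=
  ZAlgebra.BimodIso.hom (H.duality k) (H.bimodIso k)

theorem isCanonicalHom_canonicalHom : H.IsCanonicalHom k (H.canonicalHom k) where
  map_deg0_zero _ := rfl
  map_deg0_one _ := rfl
  map_deg1_zero _ := rfl
  map_pair i x y ψ h := by
    -- Injectivity of `dualToHom` leaves only one possible `ψ`.
    have h' : ψ = (H.dualEquiv i).symm
        ((H.canonicalHom k).map i (i + 1) (Snc.Comp.deg1 i x)) :=
      (H.dualEquiv i).eq_symm_apply.2 h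
    rw [h']
    exact ZAlgebra.BimodIso.iter_left_iterPair (H.duality k) (H.bimodIso k) i y x

theorem IsCanonicalHom.eq_canonicalHom
    {φ : (homBimod k (H.obj (-1)) (H.obj 0)).snc.Hom (orbitAlgebra k H.obj)}
    (h : H.IsCanonicalHom k φ) : φ = H.canonicalHom k :=
  ZAlgebra.BimodIso.hom_unique (H.duality k) (H.bimodIso k) φ h.map_deg0_zero h.map_deg0_one
    h.map_deg1_zero fun i x y => h.map_pair i x y _ (H.dualToHom_dualEquiv_symm i _)

end Helix

theorem mainTheorem2 {k : Type w} [Field k] {C : Type u} [Category.{v} C] [Abelian C] [Linear k C]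
    [HasExt.{w'} C] (H : Helix C) (n : ℕ)
    (hHom : ∀ i j : ℤ, i < j → ∀ f : H.obj j ⟶ H.obj i, f = 0)
    (hExt : ∀ l : ℤ, (n : ℤ) ≤ l → ∀ i : ℤ, Subsingleton (Abelian.Ext (H.obj i) (H.obj (i + l)) 1))
    (hFin : ∀ i j : ℤ, i + 1 ≤ j → j ≤ i + n + 1 →
      Module.Finite ((orbitAlgebra k H.obj).comp j j)ᵐᵒᵖ ((orbitAlgebra k H.obj).comp i j)) :
    (orbitAlgebra k H.obj).IsConnected ∧
    (homBimod k (H.obj (-1)) (H.obj 0)).IsAdmissible ∧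
    ∃ (_ : IsLocalizing (orbitAlgebra k H.obj).tors)
      (_ : IsLocalizing (homBimod k (H.obj (-1)) (H.obj 0)).snc.tors)
      (φ : (homBimod k (H.obj (-1)) (H.obj 0)).snc.Hom (orbitAlgebra k H.obj)),
      H.IsCanonicalHom k φ ∧ (∀ φ', H.IsCanonicalHom k φ' → φ' = φ) ∧
      (∀ i : ℤ, Function.Bijective (φ.map i i) ∧ Function.Bijective (φ.map i (i + 1))) ∧
      ∃ F : (orbitAlgebra k H.obj).Proj ⥤ (homBimod k (H.obj (-1)) (H.obj 0)).snc.Proj,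
        Nonempty ((orbitAlgebra k H.obj).proj ⋙ F ≅
          φ.restriction ⋙ (homBimod k (H.obj (-1)) (H.obj 0)).snc.proj) ∧
        ∀ F' : (orbitAlgebra k H.obj).Proj ⥤ (homBimod k (H.obj (-1)) (H.obj 0)).snc.Proj,
          Nonempty ((orbitAlgebra k H.obj).proj ⋙ F' ≅
            φ.restriction ⋙ (homBimod k (H.obj (-1)) (H.obj 0)).snc.proj) →
          Nonempty (F' ≅ F) := by
  have hB := H.isConnected_orbitAlgebra k hHom
  have hX := (H.bimodIso k).isAdmissible (H.duality k) hB
  have hBloc := ZAlgebra.isLocalizing_tors (H.hasFiniteTails_orbitAlgebra k n hExt)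
  have hSloc := ZAlgebra.isLocalizing_tors (ZAlgebra.hasFiniteTails_snc hX)
  exact ⟨hB, hX, hBloc, hSloc, H.canonicalHom k, H.isCanonicalHom_canonicalHom,
    fun φ' h => h.eq_canonicalHom,
    fun i => ⟨ZAlgebra.BimodIso.hom_bijective_deg0 _ _ i,
      ZAlgebra.BimodIso.hom_bijective_deg1 _ _ i⟩,
    (H.canonicalHom k).exists_functor_proj⟩
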